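/- **Conventions.** A *represented space* is a set $X$ with a surjective partial function $\delta_X:\subseteq\mathbb N^{\mathbb N}\to X$; if $\delta_X(p)=x$, then $p$ is a *name* of $x$. A *realizer* of a partial multi-valued function $f:\subseteq X\rightrightarrows Y$ between represented spaces is a single-valued partial function $F:\subseteq\mathbb N^{\mathbb N}\to\mathbb N^{\mathbb N}$ with $\delta_Y(F(p))\in f(\delta_X(p))$ for all $p\in\mathrm{dom}(f\circ\delta_X)$, and $f$ is *computable* if it has a (Type-2) computable realizer. One writes $f\le_W g$ (*Weihrauch reducibility*) if there are computable $K,H:\subseteq\mathbb N^{\mathbb N}\to\mathbb N^{\mathbb N}$ such that $p\mapsto K\langle p,G(H(p))\rangle$ is a realizer of $f$ for every realizer $G$ of $g$. Products carry the product representation, and $(f\times g)(x,w)=f(x)\times g(w)$. A computable metric space is a metric space with a numbering of a dense subset on which the metric is computable; it carries its Cauchy representation, and this applies in particular to $\mathbb R$ with a standard numbering of the rational numbers. A natural number $n$ is named by the sequences $p$ with $p(0)=n$, and each point of $2^{\mathbb N}$ is its own name. For a represented space $X$, the closed subsets $A\subseteq X$ are represented by *negative information*: a name of $A$ is a name, in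 the canonical function space representation, of the characteristic function of $X\setminus A$ as a continuous map to Sierpiński space (in which $p$ names $1$ if and only if $p(n)=0$ for some $n$). *Closed choice* $C_X$ is the multi-valued function $A\mapsto A$ that maps each nonempty closed set $A\subseteq X$, given by negative information, to an arbitrary element of $A$. **Theorem (Quotients).** Let $X$ be a represented space, let $Y$ be a computable metric space, and let $f:\subseteq X\to Y$ be a single-valued partial function. 1. If $g$ is any partial multi-valued function on represented spaces with $f\le_W C_{2^{\mathbb N}}\times g$, then $f\le_W g$. 2. If $f\le_W C_{2^{\mathbb N}}$, then $f$ is computable. 3. If $f\le_W C_{\mathbb R}$, then $f\le_W C_{\mathbb N}$. -/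

import Mathlib

/-! ### Baire space, words and computable functions -/

/-- Baire space. -/
abbrev Baire : Type := ℕ → ℕ

/-- The finite prefix `p 0, …, p (n - 1)` of the sequence `p`. -/
def Baire.prefix (p : Baire) (n : ℕ) : List ℕ := (List.range n).map p

/-- The pairing `⟨p, q⟩ = p 0, q 0, p 1, q 1, …` on Baire space. -/
def Baire.pair (p q : Baire) : Baire := fun n => if n % 2 = 0 then p (n / 2) else q (n / 2)

/-- First projection of the pairing. -/
def Baire.fst (p : Baire) : Baire := fun n => p (2 * n)

/-- Second projection of the pairing. -/
def Baire.snd (p : Baire) : Baire := fun n => p (2 * n + 1)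

/-- Type-2 computability of a partial function on Baire space: some computable word function `h`,
monotone for the prefix order, approximates `F`. The word `h w` is what the machine has written
after reading `w`; the function is defined exactly where the output is infinite. -/
def TypeTwoComputable (F : Baire →. Baire) : Prop :=
  ∃ h : List ℕ → List ℕ, Computable h ∧ (∀ u v, u <+: v → h u <+: h v) ∧
    ∀ p q, q ∈ F p ↔ ∀ n, ∃ m, q.prefix n <+: h (p.prefix m)

/-- The standard universal continuous partial function `q ↦ η_p(q)` on Baire space (Kleene's
associates): the `n`-th output is `c - 1`, for the first nonzero value `c` of `p` on the codes
of `(n, q.prefix m)`, `m = 0, 1, 2, …`. It is defined where all outputs are. -/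
def Baire.apply (p : Baire) : Baire →. Baire := fun q =>
  ⟨∀ n, ∃ m, p (Nat.pair n (Encodable.encode (q.prefix m))) ≠ 0,
    fun h n => p (Nat.pair n (Encodable.encode (q.prefix (Nat.find (h n))))) - 1⟩

/-! ### Represented spaces, realizers and reducibility -/

/-- A represented space: `IsName p x` is the graph `δ(p) = x` of a surjective single-valued
partial function `δ` from Baire space. -/
class RepresentedSpace (X : Type*) where
  IsName : Baire → X → Prop
  unique : ∀ {p x y}, IsName p x → IsName p y → x = y
  exists_name : ∀ x, ∃ p, IsName p x

/-- Partial multi-valued functions; the domain is the set of points with a nonempty value. -/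
abbrev MultiMap (X Y : Type*) : Type _ := X → Set Y

/-- A single-valued partial function as a multi-valued one. -/
def PFun.toMultiMap {X Y : Type*} (f : X →. Y) : MultiMap X Y := fun x => {y | y ∈ f x}

/-- `(f × g)(x, w) = f(x) × g(w)`. -/
def MultiMap.prod {X Y W Z : Type*} (f : MultiMap X Y) (g : MultiMap W Z) :
    MultiMap (X × W) (Y × Z) := fun x => f x.1 ×ˢ g x.2

/-- `F` is a realizer of `f`: it maps each name of a point `x` of the domain of `f`
to a name of some element of `f x`. -/
def Realizes {X Y : Type*} [RepresentedSpace X] [RepresentedSpace Y]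
    (F : Baire →. Baire) (f : MultiMap X Y) : Prop :=
  ∀ p x, RepresentedSpace.IsName p x → (f x).Nonempty →
    ∃ q ∈ F p, ∃ y ∈ f x, RepresentedSpace.IsName q y

/-- A function between represented spaces is computable if it has a computable realizer. -/
def MultiMap.IsComputable {X Y : Type*} [RepresentedSpace X] [RepresentedSpace Y]
    (f : MultiMap X Y) : Prop :=
  ∃ F : Baire →. Baire, TypeTwoComputable F ∧ Realizes F f

/-- Weihrauch reducibility: there are computable `K`, `H` such that `K ∘ ⟨id, G ∘ H⟩` realizes `f`
for every realizer `G` of `g`. -/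
def WeihrauchLE {X Y U V : Type*} [RepresentedSpace X] [RepresentedSpace Y]
    [RepresentedSpace U] [RepresentedSpace V] (f : MultiMap X Y) (g : MultiMap U V) : Prop :=
  ∃ K H : Baire →. Baire, TypeTwoComputable K ∧ TypeTwoComputable H ∧
    ∀ G : Baire →. Baire, Realizes G g →
      Realizes (fun p => (H p).bind fun q => (G q).bind fun r => K (p.pair r)) f

infix:50 " ≤W " => WeihrauchLE

theorem Baire.fst_pair (p q : Baire) : (p.pair q).fst = p := by
  funext n; simp [Baire.fst, Baire.pair]

theorem Baire.snd_pair (p q : Baire) : (p.pair q).snd = q := by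
  funext n
  have h1 : (2 * n + 1) % 2 ≠ 0 := by omega
  have h2 : (2 * n + 1) / 2 = n := by omega
  simp [Baire.snd, Baire.pair, h2]

/-- The product representation. -/
instance {X Y : Type*} [RepresentedSpace X] [RepresentedSpace Y] : RepresentedSpace (X × Y) where
  IsName p z := RepresentedSpace.IsName p.fst z.1 ∧ RepresentedSpace.IsName p.snd z.2
  unique h h' := Prod.ext (RepresentedSpace.unique h.1 h'.1) (RepresentedSpace.unique h.2 h'.2)
  exists_name z := by
    obtain ⟨p, hp⟩ := RepresentedSpace.exists_name z.1
    obtain ⟨q, hq⟩ := RepresentedSpace.exists_name z.2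
    exact ⟨p.pair q, by rwa [Baire.fst_pair], by rwa [Baire.snd_pair]⟩

/-! ### Natural numbers, Cantor space, Sierpinski space -/

/-- `δ_ℕ(p) = p(0)`. -/
instance : RepresentedSpace ℕ where
  IsName p n := p 0 = n
  unique h h' := h.symm.trans h'
  exists_name n := ⟨fun _ => n, rfl⟩

/-- Cantor space. -/
abbrev Cantor : Type := ℕ → Bool

/-- Cantor space is represented by the restriction of the identity to sequences of zeros and
ones. -/
instance : RepresentedSpace Cantor where
  IsName p x := ∀ n, p n = (x n).toNat
  unique {p x y} h h' := by
    funext n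
    have hn := (h n).symm.trans (h' n)
    cases hx : x n <;> cases hy : y n <;> simp_all
  exists_name x := ⟨fun n => (x n).toNat, fun _ => rfl⟩

/-- Sierpinski space, with `True` as the point `1`, so that the characteristic function of
`U : Set X` is `fun x => x ∈ U`. -/
def Sierpinski : Type := Prop

/-- A sequence names the point `1` of Sierpinski space if and only if it contains a zero. -/
instance : RepresentedSpace Sierpinski where
  IsName p s := s = (∃ n, p n = 0 : Prop)
  unique h h' := h.trans h'.symm
  exists_name s := by
    rcases Classical.em (s : Prop) with hs | hs
    · exact ⟨fun _ => 0, propext ⟨fun _ => ⟨0, rfl⟩, fun _ => hs⟩⟩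
    · exact ⟨fun _ => 1, propext ⟨fun h => absurd h hs, fun ⟨_, h⟩ => absurd h one_ne_zero⟩⟩

/-! ### Closed sets with negative information and closed choice -/

/-- The characteristic function of the complement of `A`, as a function to Sierpinski space. -/
def charCompl {X : Type*} (A : Set X) : MultiMap X Sierpinski :=
  fun x => {(show Sierpinski from (x ∉ A : Prop))}

/-- The space `𝒜₋(X)` of closed subsets of a represented space: those whose complement has a
continuous characteristic function into Sierpinski space, that is, one realized by some
`η_p`. -/
def ClosedSet (X : Type*) [RepresentedSpace X] : Type _ :=
  {A : Set X // ∃ p : Baire, Realizes p.apply (charCompl A)}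

/-- A name of a closed set `A` is a name, in the function space representation, of the
characteristic function of its complement. -/
instance {X : Type*} [RepresentedSpace X] : RepresentedSpace (ClosedSet X) where
  IsName p A := Realizes p.apply (charCompl A.1)
  unique {p A B} hA hB := by
    apply Subtype.ext
    ext x
    obtain ⟨q, hq⟩ := RepresentedSpace.exists_name x
    obtain ⟨r, hr, y, hy, hry⟩ := hA q x hq (Set.singleton_nonempty _)
    obtain ⟨r', hr', y', hy', hry'⟩ := hB q x hq (Set.singleton_nonempty _)
    obtain rfl := Part.mem_unique hr hr'
    have hyy := RepresentedSpace.unique hry hry'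
    rw [Set.mem_singleton_iff.mp hy, Set.mem_singleton_iff.mp hy'] at hyy
    exact not_iff_not.mp (iff_of_eq hyy)
  exists_name A := A.2

/-- Closed choice `C_X : A ↦ A`, defined on the nonempty closed subsets of `X`. -/
def closedChoice (X : Type*) [RepresentedSpace X] : MultiMap (ClosedSet X) X := fun A => A.1

/-! ### Computable metric spaces -/

/-- The standard numbering `⟨⟨a, b⟩, c⟩ ↦ (a - b) / (c + 1)` of the rational numbers. -/
def ratNumbering (n : ℕ) : ℚ :=
  ((n.unpair.1.unpair.1 : ℚ) - n.unpair.1.unpair.2) / ((n.unpair.2 : ℚ) + 1)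

/-- A computable metric space: a metric space with a numbering of a dense subset, on which the
metric is a computable double sequence of real numbers. -/
class ComputableMetricSpace (X : Type*) [MetricSpace X] where
  numbering : ℕ → X
  denseRange_numbering : DenseRange numbering
  dist_computable : ∃ c : ℕ × ℕ × ℕ → ℕ, Computable c ∧ ∀ i j k,
    |dist (numbering i) (numbering j) - (ratNumbering (c (i, j, k)) : ℝ)| < (2 : ℝ)⁻¹ ^ k

/-- The Cauchy representation: `p` names the limit of the rapidly converging sequence
`α (p 0), α (p 1), …`, where `α` is the numbering of the dense subset. -/
instance {X : Type*} [MetricSpace X] [ComputableMetricSpace X] : RepresentedSpace X where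
  IsName p x :=
    (∀ i j, j < i → dist (ComputableMetricSpace.numbering (p i) : X)
      (ComputableMetricSpace.numbering (p j)) < (2 : ℝ)⁻¹ ^ j) ∧
    Filter.Tendsto (fun n => (ComputableMetricSpace.numbering (p n) : X)) Filter.atTop (nhds x)
  unique h h' := tendsto_nhds_unique h.2 h'.2
  exists_name x := by
    have hd := ComputableMetricSpace.denseRange_numbering (X := X)
    have key : ∀ n : ℕ, ∃ m, dist x (ComputableMetricSpace.numbering m : X) < (2 : ℝ)⁻¹ ^ (n + 1) :=
      fun n => hd.exists_dist_lt x (by positivity)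
    choose p hp using key
    refine ⟨p, fun i j hij => ?_, ?_⟩
    · have h1 := dist_triangle_left (ComputableMetricSpace.numbering (p i) : X)
        (ComputableMetricSpace.numbering (p j)) x
      have h2 : (2 : ℝ)⁻¹ ^ (i + 1) ≤ (2 : ℝ)⁻¹ ^ (j + 1) :=
        pow_le_pow_of_le_one (by norm_num) (by norm_num) (by omega)
      have h3 : (2 : ℝ)⁻¹ ^ (j + 1) + (2 : ℝ)⁻¹ ^ (j + 1) = (2 : ℝ)⁻¹ ^ j := by ring
      linarith [hp i, hp j]
    · rw [tendsto_iff_dist_tendsto_zero]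
      refine squeeze_zero (fun _ => dist_nonneg) (fun n => ?_)
        ((tendsto_pow_atTop_nhds_zero_of_lt_one (r := (2 : ℝ)⁻¹) (by norm_num)
          (by norm_num)).comp (Filter.tendsto_add_atTop_nat 1))
      rw [dist_comm]
      exact (hp n).le

theorem ratNumbering_surjective : Function.Surjective ratNumbering := by
  intro q
  refine ⟨Nat.pair (Nat.pair q.num.toNat (-q.num).toNat) (q.den - 1), ?_⟩
  have h1 : ((q.num.toNat : ℚ) - ((-q.num).toNat : ℚ)) = q.num := by
    have : ((q.num.toNat : ℤ) - ((-q.num).toNat : ℤ)) = q.num := by omega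
    exact_mod_cast this
  have h2 : (((q.den - 1 : ℕ) : ℚ) + 1) = q.den := by
    have : q.den - 1 + 1 = q.den := Nat.sub_add_cancel q.pos
    exact_mod_cast this
  simp only [ratNumbering, Nat.unpair_pair]
  rw [h1, h2, Rat.num_div_den]

/-- A code of the distance of the rational numbers with codes `i` and `j`. -/
def ratDistCode (i j : ℕ) : ℕ :=
  let P := i.unpair.1.unpair.1 * (j.unpair.2 + 1) + j.unpair.1.unpair.2 * (i.unpair.2 + 1)
  let Q := i.unpair.1.unpair.2 * (j.unpair.2 + 1) + j.unpair.1.unpair.1 * (i.unpair.2 + 1)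
  Nat.pair (Nat.pair ((P - Q) + (Q - P)) 0) ((i.unpair.2 + 1) * (j.unpair.2 + 1) - 1)

theorem ratNumbering_ratDistCode (i j : ℕ) :
    ratNumbering (ratDistCode i j) = |ratNumbering i - ratNumbering j| := by
  have habs : ∀ P Q : ℕ, (((P - Q) + (Q - P) : ℕ) : ℚ) = |(P : ℚ) - Q| := by
    intro P Q
    rcases le_total P Q with h | h
    · rw [Nat.sub_eq_zero_of_le h, abs_sub_comm,
        abs_of_nonneg (sub_nonneg.mpr (by exact_mod_cast h))]
      simp [Nat.cast_sub h]
    · rw [Nat.sub_eq_zero_of_le h, abs_of_nonneg (sub_nonneg.mpr (by exact_mod_cast h))]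
      simp [Nat.cast_sub h]
  have hden : ∀ a b : ℕ, (((a + 1) * (b + 1) - 1 : ℕ) : ℚ) + 1 = ((a : ℚ) + 1) * (b + 1) := by
    intro a b
    have : (a + 1) * (b + 1) - 1 + 1 = (a + 1) * (b + 1) :=
      Nat.sub_add_cancel (Nat.mul_pos (by omega) (by omega))
    exact_mod_cast this
  simp only [ratNumbering, ratDistCode, Nat.unpair_pair]
  rw [habs, hden]
  generalize i.unpair.1.unpair.1 = a
  generalize i.unpair.1.unpair.2 = b
  generalize i.unpair.2 = c
  generalize j.unpair.1.unpair.1 = a'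
  generalize j.unpair.1.unpair.2 = b'
  generalize j.unpair.2 = c'
  have hc : (0 : ℚ) < (c : ℚ) + 1 := by positivity
  have hc' : (0 : ℚ) < (c' : ℚ) + 1 := by positivity
  rw [div_sub_div _ _ hc.ne' hc'.ne', abs_div, abs_of_pos (mul_pos hc hc')]
  push_cast
  rw [sub_zero]
  congr 2
  ring

theorem ratDistCode_primrec : Primrec₂ ratDistCode := by
  have u1 : Primrec fun n : ℕ => n.unpair.1 := Primrec.fst.comp Primrec.unpair
  have u2 : Primrec fun n : ℕ => n.unpair.2 := Primrec.snd.comp Primrec.unpair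
  have ia : Primrec fun x : ℕ × ℕ => x.1.unpair.1.unpair.1 := u1.comp (u1.comp Primrec.fst)
  have ib : Primrec fun x : ℕ × ℕ => x.1.unpair.1.unpair.2 := u2.comp (u1.comp Primrec.fst)
  have ic : Primrec fun x : ℕ × ℕ => x.1.unpair.2 + 1 :=
    Primrec.succ.comp (u2.comp Primrec.fst)
  have ja : Primrec fun x : ℕ × ℕ => x.2.unpair.1.unpair.1 := u1.comp (u1.comp Primrec.snd)
  have jb : Primrec fun x : ℕ × ℕ => x.2.unpair.1.unpair.2 := u2.comp (u1.comp Primrec.snd)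
  have jc : Primrec fun x : ℕ × ℕ => x.2.unpair.2 + 1 :=
    Primrec.succ.comp (u2.comp Primrec.snd)
  have hP := Primrec.nat_add.comp (Primrec.nat_mul.comp ia jc) (Primrec.nat_mul.comp jb ic)
  have hQ := Primrec.nat_add.comp (Primrec.nat_mul.comp ib jc) (Primrec.nat_mul.comp ja ic)
  exact Primrec₂.natPair.comp
    (Primrec₂.natPair.comp
      (Primrec.nat_add.comp (Primrec.nat_sub.comp hP hQ) (Primrec.nat_sub.comp hQ hP))
      (Primrec.const 0))
    (Primrec.nat_sub.comp (Primrec.nat_mul.comp ic jc) (Primrec.const 1))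

/-- The Euclidean line, with the standard numbering of the rational numbers. -/
instance : ComputableMetricSpace ℝ where
  numbering n := (ratNumbering n : ℝ)
  denseRange_numbering := Rat.denseRange_cast.comp ratNumbering_surjective.denseRange
    Rat.continuous_coe_real
  dist_computable := by
    refine ⟨fun x => ratDistCode x.1 x.2.1,
      (ratDistCode_primrec.comp Primrec.fst (Primrec.fst.comp Primrec.snd)).to_comp,
      fun i j k => ?_⟩
    simp only [ratNumbering_ratDistCode, Real.dist_eq]
    push_cast
    simp

/-! Let A be a nonempty co-c.e. closed subset of Cantor space, and let a computable K turn every c ∈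
A into a name of one and the same point y of a computable metric space. Then y can be computed
without choosing. To approximate y, search for a length k and a point m of the dense subset such
that each of the 2^k binary words of length k either has been recognized as leaving A or has already
made K write an approximation close to m. The search succeeds by compactness. Its result is correct
because a fixed c₀ ∈ A is never rejected, so m has been compared with a true approximation of y.
Different c may give different names of y; a closeness test that is decidable up to a constant
factor suffices to compare them. This is `exists_typeTwoComputable_of_compact`.

For a reduction to compact choice alone, A is the instance that the reduction computes. With a
further factor g, the oracle for g is consulted first: the solutions of a product instance form a
product set, so one answer r fits every c ∈ A, and the search runs with r fixed.

For choice on the line, the intervals [a, a + 1] with a rational cover ℝ, and binary expansions map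
Cantor space onto each of them. The codes of those a whose interval meets A form a co-c.e. set,
because emptiness is semidecidable by the same search through binary words
(`exists_computable_isEmpty`). Choice on ℕ yields one such a, and the preimage of A in Cantor space
is again a nonempty compact set.

Two tools are used throughout. `exists_instance_of_realizes` replaces the quantifier over all
realizers by the statement that every name of every solution of the computed instance works.
`exists_typeTwoComputable_search` builds a machine from a decidable predicate on finite prefixes. -/

/-! ### Bounded search and computability of list operations -/

/-- The least `j < n` with `q j`, or `n` if there is none. -/
def boundedFind (q : ℕ → Bool) (n : ℕ) : ℕ :=
  Nat.rec 0 (fun k r => if r < k then r else if q k then k else k + 1) n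

theorem boundedFind_succ (q : ℕ → Bool) (n : ℕ) : boundedFind q (n + 1) =
    if boundedFind q n < n then boundedFind q n else if q n then n else n + 1 := rfl

theorem boundedFind_le (q : ℕ → Bool) (n : ℕ) : boundedFind q n ≤ n := by
  induction n with
  | zero => exact le_rfl
  | succ n ih => rw [boundedFind_succ]; split_ifs <;> omega

theorem not_of_lt_boundedFind (q : ℕ → Bool) (n j : ℕ) (h : j < boundedFind q n) :
    q j = false := by
  induction n with
  | zero => exact absurd h (Nat.not_lt_zero _)
  | succ n ih =>
    have hle := boundedFind_le q n
    rw [boundedFind_succ] at h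
    split_ifs at h with h1 h2
    · exact ih h
    · exact ih (by omega)
    · rcases Nat.lt_or_ge j n with h3 | h3
      · exact ih (by omega)
      · obtain rfl : j = n := by omega
        simpa using h2

theorem boundedFind_spec (q : ℕ → Bool) (n : ℕ) (h : boundedFind q n < n) :
    q (boundedFind q n) = true := by
  induction n with
  | zero => exact absurd h (Nat.not_lt_zero _)
  | succ n ih =>
    rw [boundedFind_succ] at h ⊢
    split_ifs at h ⊢ with h1 h2
    · exact ih h1
    · exact h2
    · omega

theorem boundedFind_eq {q : ℕ → Bool} {n j : ℕ} (hj : j < n) (hq : q j = true)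
    (h : ∀ i < j, q i = false) : boundedFind q n = j := by
  rcases lt_trichotomy (boundedFind q n) j with h1 | h1 | h1
  · have := boundedFind_spec q n (h1.trans hj)
    rw [h _ h1] at this
    exact absurd this Bool.false_ne_true
  · exact h1
  · rw [not_of_lt_boundedFind q n j h1] at hq
    exact absurd hq Bool.false_ne_true

theorem boundedFind_eq_self_iff (q : ℕ → Bool) (n : ℕ) :
    boundedFind q n = n ↔ ∀ j < n, q j = false := by
  constructor
  · intro h j hj
    exact not_of_lt_boundedFind q n j (h.symm ▸ hj)
  · intro h
    by_contra hne
    have hlt := lt_of_le_of_ne (boundedFind_le q n) hne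
    have := boundedFind_spec q n hlt
    rw [h _ hlt] at this
    exact Bool.false_ne_true this

section Computable

variable {α β : Type*} [Primcodable α] [Primcodable β]

theorem Computable.decide_lt {f g : α → ℕ} (hf : Computable f) (hg : Computable g) :
    Computable fun a => decide (f a < g a) :=
  (Primrec.nat_lt.decide.to_comp).comp hf hg

theorem Computable.decide_eq [DecidableEq β] {f g : α → β} (hf : Computable f)
    (hg : Computable g) : Computable fun a => decide (f a = g a) :=
  (Primrec.eq.decide.to_comp).comp hf hg

theorem Computable.and {f g : α → Bool} (hf : Computable f) (hg : Computable g) :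
    Computable fun a => f a && g a :=
  Primrec.and.to_comp.comp hf hg

theorem Computable.or {f g : α → Bool} (hf : Computable f) (hg : Computable g) :
    Computable fun a => f a || g a :=
  Primrec.or.to_comp.comp hf hg

theorem Computable.not {f : α → Bool} (hf : Computable f) : Computable fun a => !(f a) :=
  Primrec.not.to_comp.comp hf

theorem Computable.if_lt {f g : α → ℕ} {s t : α → β} (hf : Computable f) (hg : Computable g)
    (hs : Computable s) (ht : Computable t) :
    Computable fun a => if f a < g a then s a else t a :=
  (Computable.cond (hf.decide_lt hg) hs ht).of_eq fun a => by
    by_cases h : f a < g a <;> simp [h]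

theorem Computable.if_eq {f g : α → ℕ} {s t : α → β} (hf : Computable f) (hg : Computable g)
    (hs : Computable s) (ht : Computable t) :
    Computable fun a => if f a = g a then s a else t a :=
  (Computable.cond (hf.decide_eq hg) hs ht).of_eq fun a => by
    by_cases h : f a = g a <;> simp [h]

theorem Computable.nat_add {f g : α → ℕ} (hf : Computable f) (hg : Computable g) :
    Computable fun a => f a + g a := Primrec.nat_add.to_comp.comp hf hg

theorem Computable.nat_sub {f g : α → ℕ} (hf : Computable f) (hg : Computable g) :
    Computable fun a => f a - g a := Primrec.nat_sub.to_comp.comp hf hg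

theorem Computable.nat_mul {f g : α → ℕ} (hf : Computable f) (hg : Computable g) :
    Computable fun a => f a * g a := Primrec.nat_mul.to_comp.comp hf hg

theorem Computable.nat_div {f g : α → ℕ} (hf : Computable f) (hg : Computable g) :
    Computable fun a => f a / g a := Primrec.nat_div.to_comp.comp hf hg

theorem Computable.nat_mod {f g : α → ℕ} (hf : Computable f) (hg : Computable g) :
    Computable fun a => f a % g a := Primrec.nat_mod.to_comp.comp hf hg

theorem Computable.nat_pair {f g : α → ℕ} (hf : Computable f) (hg : Computable g) :
    Computable fun a => Nat.pair (f a) (g a) := Primrec₂.natPair.to_comp.comp hf hg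

theorem Computable.unpair_fst {f : α → ℕ} (hf : Computable f) :
    Computable fun a => (f a).unpair.1 := Computable.fst.comp (Computable.unpair.comp hf)

theorem Computable.unpair_snd {f : α → ℕ} (hf : Computable f) :
    Computable fun a => (f a).unpair.2 := Computable.snd.comp (Computable.unpair.comp hf)

theorem Computable.two_pow {f : α → ℕ} (hf : Computable f) : Computable fun a => 2 ^ f a := by
  refine (Computable.nat_rec (f := f) (g := fun _ => 1) (h := fun _ x => 2 * x.2) hf
    (Computable.const 1) (Computable.nat_mul (Computable.const 2)
      (Computable.snd.comp Computable.snd)).to₂).of_eq fun a => ?_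
  induction f a with
  | zero => rfl
  | succ n ih => rw [pow_succ', ← ih]

theorem Computable.list_take {f : α → ℕ} {l : α → List β} (hf : Computable f)
    (hl : Computable l) : Computable fun a => (l a).take (f a) :=
  Primrec.list_take.to_comp.comp hf hl

theorem Computable.getElem? {f : α → ℕ} {l : α → List β} (hl : Computable l)
    (hf : Computable f) : Computable fun a => (l a)[f a]? :=
  Computable.list_getElem?.comp hl hf

theorem Computable.getD_zero {f : α → ℕ} {l : α → List ℕ} (hl : Computable l)
    (hf : Computable f) : Computable fun a => (l a).getD (f a) 0 :=
  (Primrec.list_getD 0).to_comp.comp hl hf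

theorem Computable.list_map_range {f : α → ℕ} {g : α → ℕ → β} (hf : Computable f)
    (hg : Computable₂ g) : Computable fun a => (List.range (f a)).map (g a) := by
  refine (Computable.nat_rec (f := f) (g := fun _ => ([] : List β))
    (h := fun a x => x.2 ++ [g a x.1]) hf (Computable.const [])
    (Computable.list_concat.comp (Computable.snd.comp Computable.snd)
      (hg.comp Computable.fst (Computable.fst.comp Computable.snd))).to₂).of_eq fun a => ?_
  induction f a with
  | zero => rfl
  | succ n ih => rw [List.range_succ, List.map_append, ← ih]; rfl

theorem Computable.boundedFind {f : α → ℕ} {q : α → ℕ → Bool} (hf : Computable f)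
    (hq : Computable₂ q) : Computable fun a => boundedFind (q a) (f a) := by
  have h1 : Computable fun x : α × ℕ × ℕ => x.2.1 := Computable.fst.comp Computable.snd
  have h2 : Computable fun x : α × ℕ × ℕ => x.2.2 := Computable.snd.comp Computable.snd
  refine (Computable.nat_rec (f := f) (g := fun _ => 0)
    (h := fun a x => if x.2 < x.1 then x.2 else bif q a x.1 then x.1 else x.1 + 1) hf
    (Computable.const 0) (Computable.if_lt h2 h1 h2 (Computable.cond
      (hq.comp Computable.fst h1) h1 (Computable.succ.comp h1))).to₂).of_eq fun a => ?_
  induction f a with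
  | zero => rfl
  | succ n ih => rw [boundedFind_succ, ← ih]; cases h : q a n <;> simp [h]

/-- A search for a counterexample returns its bound exactly when there is none. -/
theorem Computable.forall_lt {f : α → ℕ} {q : α → ℕ → Bool} (hf : Computable f)
    (hq : Computable₂ q) : Computable fun a => decide (∀ j < f a, q a j = true) := by
  refine (Computable.decide_eq (Computable.boundedFind hf
    (q := fun a j => !(q a j)) (Computable.not hq).to₂) hf).of_eq fun a => ?_
  simp [boundedFind_eq_self_iff]

theorem Computable.list_mem {l : α → List ℕ} {f : α → ℕ} (hl : Computable l)
    (hf : Computable f) : Computable fun a => decide (f a ∈ l a) := by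
  refine (Computable.decide_lt ((Primrec.list_idxOf (α := ℕ)).to_comp.comp hf hl)
    (Computable.list_length.comp hl)).of_eq fun a => ?_
  simp [List.idxOf_lt_length_iff]

end Computable

/-! ### Prefixes -/

theorem Baire.length_prefix (p : Baire) (n : ℕ) : (p.prefix n).length = n := by
  simp [Baire.prefix]

theorem Baire.getElem?_prefix (p : Baire) {n i : ℕ} (h : i < n) :
    (p.prefix n)[i]? = some (p i) := by
  simp [Baire.prefix, h]

theorem Baire.getD_prefix (p : Baire) {n i : ℕ} (h : i < n) :
    (p.prefix n).getD i 0 = p i := by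
  simp [Baire.prefix, h]

theorem Baire.take_prefix (p : Baire) {j n : ℕ} (h : j ≤ n) :
    (p.prefix n).take j = p.prefix j := by
  rw [Baire.prefix, ← List.map_take, List.take_range, min_eq_left h, Baire.prefix]

theorem Baire.prefix_mono (p : Baire) {m n : ℕ} (h : m ≤ n) : p.prefix m <+: p.prefix n := by
  rw [← p.take_prefix h]; exact List.take_prefix _ _

theorem Baire.prefix_congr {p q : Baire} {n : ℕ} (h : ∀ i < n, p i = q i) :
    p.prefix n = q.prefix n :=
  List.map_congr_left fun i hi => h i (List.mem_range.mp hi)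

theorem Baire.prefix_isPrefix_iff (q : Baire) (n : ℕ) (w : List ℕ) :
    q.prefix n <+: w ↔ ∀ i < n, w[i]? = some (q i) := by
  rw [List.prefix_iff_getElem?]
  simp [Baire.prefix]

theorem List.IsPrefix.getElem?_eq_some {α : Type*} {u v : List α} (h : u <+: v) {i : ℕ} {a : α}
    (ha : u[i]? = some a) : v[i]? = some a := by
  obtain ⟨t, rfl⟩ := h
  rw [List.getElem?_append_left (List.getElem?_eq_some_iff.mp ha).1, ha]

/-! ### Closure properties of Type-2 computable functions -/

/-- Approximation of the values of a computable function by its word function. -/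
theorem TypeTwoComputable.exists_approx {F : Baire →. Baire} (hF : TypeTwoComputable F) :
    ∃ h : List ℕ → List ℕ, Computable h ∧
      (∀ (p : Baire) k k', k ≤ k' → h (p.prefix k) <+: h (p.prefix k')) ∧
      ∀ p q, q ∈ F p → ∀ n, (∃ k, (h (p.prefix k))[n]? = some (q n)) ∧
        ∀ k m, (h (p.prefix k))[n]? = some m → q n = m := by
  obtain ⟨h, hc, hm, hF⟩ := hF
  refine ⟨h, hc, fun p k k' hk => hm _ _ (p.prefix_mono hk), fun p q hq n => ?_⟩
  obtain ⟨k, hk⟩ := (hF p q).mp hq (n + 1)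
  have hk := (q.prefix_isPrefix_iff _ _).mp hk n (Nat.lt_succ_self n)
  refine ⟨⟨k, hk⟩, fun k' m hm' => ?_⟩
  have h1 := (hm _ _ (p.prefix_mono (le_max_left k k'))).getElem?_eq_some hk
  have h2 := (hm _ _ (p.prefix_mono (le_max_right k k'))).getElem?_eq_some hm'
  exact Option.some.inj (h1.symm.trans h2)

/-- The machine that searches, for each output position, a value certified by a computable
predicate of the finite prefixes of the input. -/
theorem exists_typeTwoComputable_search (P : List ℕ → ℕ → ℕ → Bool)
    (hP : Computable fun x : List ℕ × ℕ × ℕ => P x.1 x.2.1 x.2.2) :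
    ∃ F : Baire →. Baire, TypeTwoComputable F ∧
      ∀ p : Baire, (∀ n, ∃ k m, P (p.prefix k) n m = true) →
        ∃ q ∈ F p, ∀ n, ∃ k, P (p.prefix k) n (q n) = true := by
  classical
  -- The number `j` codes a prefix length and a candidate value. The coded length is at most `j`, so
  -- for `j < u.length` the verdict does not change when `u` grows. The monotonicity of the machine
  -- rests on this.
  let Q : List ℕ → ℕ → ℕ → Bool := fun u n j => P (u.take j.unpair.1) n j.unpair.2
  let step : List ℕ → ℕ → ℕ := fun u n => boundedFind (Q u n) u.length
  let N : List ℕ → ℕ := fun u => boundedFind (fun n => !(decide (step u n < u.length))) u.length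
  let h : List ℕ → List ℕ := fun u => (List.range (N u)).map fun n => (step u n).unpair.2
  have hstep : Computable₂ step := by
    have hg : Computable fun y : (List ℕ × ℕ) × ℕ =>
        (y.1.1.take y.2.unpair.1, y.1.2, y.2.unpair.2) :=
      Computable.pair (Computable.list_take (Computable.unpair_fst Computable.snd)
        (Computable.fst.comp Computable.fst)) (Computable.pair (Computable.snd.comp Computable.fst)
          (Computable.unpair_snd Computable.snd))
    have hQ : Computable fun y : (List ℕ × ℕ) × ℕ => Q y.1.1 y.1.2 y.2 := (hP.comp hg :)
    exact Computable.boundedFind (α := List ℕ × ℕ) (f := fun x => x.1.length)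
      (q := fun x j => Q x.1 x.2 j) (Computable.list_length.comp Computable.fst) hQ.to₂
  have hN : Computable N := Computable.boundedFind Computable.list_length
    (Computable.not (Computable.decide_lt hstep
      (Computable.list_length.comp Computable.fst))).to₂
  have hh : Computable h := Computable.list_map_range hN (Computable.unpair_snd hstep).to₂
  have hstepN : ∀ u n, n < N u → step u n < u.length := by
    intro u n hn
    simpa using not_of_lt_boundedFind _ _ _ hn
  have hgetN : ∀ u n m, (h u)[n]? = some m ↔ n < N u ∧ (step u n).unpair.2 = m := by
    intro u n m
    by_cases hn : n < N u <;> simp [h, hn]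
  have hstepmono : ∀ u v n, u <+: v → step u n < u.length → step v n = step u n := by
    intro u v n huv hlt
    obtain ⟨t, rfl⟩ := huv
    have key : ∀ j < u.length, Q (u ++ t) n j = Q u n j := by
      intro j hj
      have := Nat.unpair_left_le j
      simp only [Q]
      rw [List.take_append_of_le_length (by omega)]
    refine boundedFind_eq (by simp only [List.length_append]; omega) ?_ fun i hi => ?_
    · rw [key _ hlt]; exact boundedFind_spec _ _ hlt
    · rw [key _ (by omega)]; exact not_of_lt_boundedFind _ _ _ hi
  have hNmono : ∀ u v, u <+: v → N u ≤ N v := by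
    intro u v huv
    by_contra hlt
    have hle : N u ≤ u.length := boundedFind_le _ _
    have hlen := huv.length_le
    have h1 := boundedFind_spec (fun n => !(decide (step v n < v.length))) v.length
      (show N v < v.length by omega)
    have h2 := hstepN u (N v) (by omega)
    have h3 := hstepmono u v _ huv h2
    simp only [Bool.not_eq_true', decide_eq_false_iff_not] at h1
    exact h1 (by change step v (N v) < _; omega)
  have hmono : ∀ u v, u <+: v → h u <+: h v := by
    intro u v huv
    rw [List.prefix_iff_getElem?]
    intro i hi
    have hi' : i < N u := by simpa [h] using hi
    rw [hgetN]
    refine ⟨hi'.trans_le (hNmono u v huv), ?_⟩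
    rw [hstepmono u v i huv (hstepN u i hi')]
    simp [h]
  let F : Baire →. Baire := fun p =>
    ⟨∀ n, ∃ j : ℕ, P (p.prefix j.unpair.1) n j.unpair.2 = true,
      fun H n => (Nat.find (H n)).unpair.2⟩
  have hQp : ∀ (p : Baire) n L j, j < L →
      Q (p.prefix L) n j = P (p.prefix j.unpair.1) n j.unpair.2 := by
    intro p n L j hj
    have := Nat.unpair_left_le j
    simp only [Q]
    rw [p.take_prefix (by omega)]
  have hfind : ∀ (p : Baire) n L (H : ∃ j : ℕ, P (p.prefix j.unpair.1) n j.unpair.2 = true),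
      Nat.find H < L → step (p.prefix L) n = Nat.find H := by
    intro p n L H hL
    refine boundedFind_eq (by rwa [p.length_prefix]) ?_ fun i hi => ?_
    · rw [hQp _ _ _ _ hL]; exact Nat.find_spec H
    · rw [hQp _ _ _ _ (by omega)]; simpa using Nat.find_min H hi
  have hfind' : ∀ (p : Baire) n L, step (p.prefix L) n < L →
      ∃ H : ∃ j : ℕ, P (p.prefix j.unpair.1) n j.unpair.2 = true,
        step (p.prefix L) n = Nat.find H := by
    intro p n L hlt
    have h1 := boundedFind_spec (Q (p.prefix L) n) (p.prefix L).length
      (hlt.trans_eq (p.length_prefix L).symm)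
    change Q (p.prefix L) n (step (p.prefix L) n) = true at h1
    rw [hQp _ _ _ _ hlt] at h1
    have H : ∃ j : ℕ, P (p.prefix j.unpair.1) n j.unpair.2 = true := ⟨_, h1⟩
    exact ⟨H, hfind p n L H ((Nat.find_min' H h1).trans_lt hlt)⟩
  refine ⟨F, ⟨h, hh, hmono, fun p q => ⟨?_, ?_⟩⟩, ?_⟩
  · rintro ⟨H, rfl⟩ n
    -- Both `step` and `N` search only below the length of the word, so the prefix must be longer
    -- than `n` and than each of the first `n` search results.
    refine ⟨n + 1 + ∑ i ∈ Finset.range n, Nat.find (H i), ?_⟩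
    set L := n + 1 + ∑ i ∈ Finset.range n, Nat.find (H i) with hL
    have hlt : ∀ i < n, Nat.find (H i) < L := by
      intro i hi
      have := Finset.single_le_sum (f := fun i => Nat.find (H i)) (fun _ _ => Nat.zero_le _)
        (Finset.mem_range.mpr hi)
      omega
    have hNn : n ≤ N (p.prefix L) := by
      by_contra hcon
      have hcon' : N (p.prefix L) < n := by omega
      have h1 := boundedFind_spec (fun n => !(decide (step (p.prefix L) n < (p.prefix L).length)))
        (p.prefix L).length
        (lt_of_lt_of_eq (show N (p.prefix L) < L by omega) (p.length_prefix L).symm)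
      simp only [Bool.not_eq_true', decide_eq_false_iff_not] at h1
      refine h1 ?_
      change step (p.prefix L) (N (p.prefix L)) < _
      rw [hfind p _ L (H _) (hlt _ hcon'), p.length_prefix]
      exact hlt _ hcon'
    rw [Baire.prefix_isPrefix_iff]
    intro i hi
    rw [hgetN]
    refine ⟨by omega, ?_⟩
    rw [hfind p i L (H i) (hlt i hi)]
  · intro H
    have key : ∀ n, ∃ H : ∃ j : ℕ, P (p.prefix j.unpair.1) n j.unpair.2 = true,
        (Nat.find H).unpair.2 = q n := by
      intro n
      obtain ⟨m, hm⟩ := H (n + 1)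
      have h1 := (q.prefix_isPrefix_iff _ _).mp hm n (Nat.lt_succ_self n)
      rw [hgetN] at h1
      have h2 := hstepN _ _ h1.1
      rw [p.length_prefix] at h2
      obtain ⟨H', h3⟩ := hfind' p n m h2
      exact ⟨H', h3 ▸ h1.2⟩
    exact ⟨fun n => (key n).1, funext fun n => (key n).2⟩
  · intro p H
    have H' : ∀ n, ∃ j : ℕ, P (p.prefix j.unpair.1) n j.unpair.2 = true := by
      intro n
      obtain ⟨k, m, hkm⟩ := H n
      exact ⟨Nat.pair k m, by simpa using hkm⟩
    exact ⟨_, ⟨H', rfl⟩, fun n => ⟨_, Nat.find_spec (H' n)⟩⟩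

/-- A monotone computable word function computes every sequence it approximates. -/
theorem exists_typeTwoComputable_of_word (h : List ℕ → List ℕ) (hc : Computable h)
    (hm : ∀ u v, u <+: v → h u <+: h v) :
    ∃ F : Baire →. Baire, TypeTwoComputable F ∧
      ∀ p q : Baire, (∀ n, ∃ k, (h (p.prefix k))[n]? = some (q n)) → q ∈ F p := by
  obtain ⟨F, hF, hFs⟩ := exists_typeTwoComputable_search
    (fun u n m => decide ((h u)[n]? = some m))
    (Computable.decide_eq (Computable.getElem? (hc.comp Computable.fst)
      (Computable.fst.comp Computable.snd))
      (Computable.option_some.comp (Computable.snd.comp Computable.snd)))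
  refine ⟨F, hF, fun p q hq => ?_⟩
  obtain ⟨q', hq', hv⟩ := hFs p fun n => (hq n).imp fun k hk => ⟨q n, by simpa using hk⟩
  have : q' = q := by
    funext n
    obtain ⟨k, hk⟩ := hv n
    obtain ⟨k', hk'⟩ := hq n
    have h1 := (hm _ _ (p.prefix_mono (le_max_left k k'))).getElem?_eq_some (by simpa using hk)
    have h2 := (hm _ _ (p.prefix_mono (le_max_right k k'))).getElem?_eq_some hk'
    exact Option.some.inj (h1.symm.trans h2)
  exact this ▸ hq'

/-- Word functions compose: once the second machine has written enough of `r`, the first one writes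
the required prefix of `q`. Only an extension of the composite is claimed, which is all that
realizers need. -/
theorem TypeTwoComputable.comp {F G : Baire →. Baire} (hF : TypeTwoComputable F)
    (hG : TypeTwoComputable G) :
    ∃ F' : Baire →. Baire, TypeTwoComputable F' ∧ ∀ p r q, r ∈ G p → q ∈ F r → q ∈ F' p := by
  obtain ⟨f, fc, fm, hF⟩ := hF
  obtain ⟨g, gc, gm, hG⟩ := hG
  obtain ⟨F', hF', h⟩ := exists_typeTwoComputable_of_word (fun u => f (g u)) (fc.comp gc)
    fun u v huv => fm _ _ (gm _ _ huv)
  refine ⟨F', hF', fun p r q hr hq => h p q fun n => ?_⟩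
  obtain ⟨k, hk⟩ := (hF r q).mp hq (n + 1)
  obtain ⟨k', hk'⟩ := (hG p r).mp hr k
  exact ⟨k', (fm _ _ hk').getElem?_eq_some
    ((q.prefix_isPrefix_iff _ _).mp hk n (Nat.lt_succ_self n))⟩

theorem TypeTwoComputable.pair {F G : Baire →. Baire} (hF : TypeTwoComputable F)
    (hG : TypeTwoComputable G) : ∃ F' : Baire →. Baire, TypeTwoComputable F' ∧
      ∀ p a b, a ∈ F p → b ∈ G p → a.pair b ∈ F' p := by
  obtain ⟨f, fc, -, hF⟩ := hF.exists_approx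
  obtain ⟨g, gc, -, hG⟩ := hG.exists_approx
  have hn : Computable fun x : List ℕ × ℕ × ℕ => x.2.1 := Computable.fst.comp Computable.snd
  have h2 : Computable fun x : List ℕ × ℕ × ℕ => x.2.1 / 2 :=
    Computable.nat_div hn (Computable.const 2)
  obtain ⟨F', hF', h⟩ := exists_typeTwoComputable_search
    (fun u n m => decide ((if n % 2 = 0 then (f u)[n / 2]? else (g u)[n / 2]?) = some m))
    (Computable.decide_eq (Computable.if_eq (Computable.nat_mod hn (Computable.const 2))
      (Computable.const 0) (Computable.getElem? (fc.comp Computable.fst) h2)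
      (Computable.getElem? (gc.comp Computable.fst) h2))
      (Computable.option_some.comp (Computable.snd.comp Computable.snd)))
  refine ⟨F', hF', fun p a b ha hb => ?_⟩
  obtain ⟨q, hq, hv⟩ := h p fun n => by
    by_cases hn : n % 2 = 0
    · obtain ⟨k, hk⟩ := (hF p a ha (n / 2)).1
      exact ⟨k, a (n / 2), by simpa [hn] using hk⟩
    · obtain ⟨k, hk⟩ := (hG p b hb (n / 2)).1
      exact ⟨k, b (n / 2), by simpa [hn] using hk⟩
  have : q = a.pair b := by
    funext n
    obtain ⟨k, hk⟩ := hv n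
    by_cases hn : n % 2 = 0
    · simp only [hn, if_true, decide_eq_true_eq] at hk
      simpa [Baire.pair, hn] using ((hF p a ha (n / 2)).2 _ _ hk).symm
    · simp only [hn, if_false, decide_eq_true_eq] at hk
      simpa [Baire.pair, hn] using ((hG p b hb (n / 2)).2 _ _ hk).symm
  exact this ▸ hq

/-- Computability of total functions on Baire space. -/
def TotalComputable (Φ : Baire → Baire) : Prop := TypeTwoComputable fun p => Part.some (Φ p)

theorem TotalComputable.of_forall_mem {Φ : Baire → Baire} {F : Baire →. Baire}
    (hF : TypeTwoComputable F) (h : ∀ p, Φ p ∈ F p) : TotalComputable Φ := by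
  have : F = fun p => Part.some (Φ p) := funext fun p => Part.eq_some_iff.mpr (h p)
  rwa [this] at hF

/-- A total function is computable if each value is computed from a prefix of computable
length. -/
theorem TotalComputable.of_modulus {Φ : Baire → Baire} {ψ : List ℕ → ℕ → ℕ} {b : ℕ → ℕ}
    (hψ : Computable₂ ψ) (hb : Computable b) (h : ∀ p n, Φ p n = ψ (p.prefix (b n)) n) :
    TotalComputable Φ := by
  have hn : Computable fun x : List ℕ × ℕ × ℕ => x.2.1 := Computable.fst.comp Computable.snd
  obtain ⟨F, hF, hFs⟩ := exists_typeTwoComputable_search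
    (fun u n m => decide (b n < u.length + 1) && decide (ψ (u.take (b n)) n = m))
    (Computable.and (Computable.decide_lt (hb.comp hn)
      (Computable.succ.comp (Computable.list_length.comp Computable.fst)))
      (Computable.decide_eq (hψ.comp (Computable.list_take (hb.comp hn) Computable.fst) hn)
        (Computable.snd.comp Computable.snd)))
  refine TotalComputable.of_forall_mem hF fun p => ?_
  obtain ⟨q, hq, hv⟩ := hFs p fun n => ⟨b n, Φ p n, by
    simp [Baire.length_prefix, Baire.take_prefix, h]⟩
  have : q = Φ p := by
    funext n
    obtain ⟨k, hk⟩ := hv n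
    simp only [Baire.length_prefix, Bool.and_eq_true, decide_eq_true_eq] at hk
    rw [h, ← hk.2, Baire.take_prefix _ (by omega)]
  exact this ▸ hq

theorem TotalComputable.fst : TotalComputable Baire.fst :=
  TotalComputable.of_modulus (ψ := fun u n => u.getD (2 * n) 0) (b := fun n => 2 * n + 1)
    (Computable.getD_zero Computable.fst
      (Computable.nat_mul (Computable.const 2) Computable.snd)).to₂
    (Computable.succ.comp (Computable.nat_mul (Computable.const 2) Computable.id))
    fun p _ => (p.getD_prefix (Nat.lt_succ_self _)).symm

theorem TotalComputable.snd : TotalComputable Baire.snd :=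
  TotalComputable.of_modulus (ψ := fun u n => u.getD (2 * n + 1) 0) (b := fun n => 2 * n + 1 + 1)
    (Computable.getD_zero Computable.fst
      (Computable.succ.comp (Computable.nat_mul (Computable.const 2) Computable.snd))).to₂
    (Computable.succ.comp (Computable.succ.comp
      (Computable.nat_mul (Computable.const 2) Computable.id)))
    fun p _ => (p.getD_prefix (Nat.lt_succ_self _)).symm

theorem TotalComputable.comp {Φ Ψ : Baire → Baire} (hΦ : TotalComputable Φ)
    (hΨ : TotalComputable Ψ) : TotalComputable fun p => Φ (Ψ p) := by
  obtain ⟨F, hF, h⟩ := TypeTwoComputable.comp hΦ hΨ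
  exact TotalComputable.of_forall_mem hF fun p => h p (Ψ p) _ (Part.mem_some _) (Part.mem_some _)

theorem TotalComputable.pair {Φ Ψ : Baire → Baire} (hΦ : TotalComputable Φ)
    (hΨ : TotalComputable Ψ) : TotalComputable fun p => (Φ p).pair (Ψ p) := by
  obtain ⟨F, hF, h⟩ := TypeTwoComputable.pair hΦ hΨ
  exact TotalComputable.of_forall_mem hF fun p => h p _ _ (Part.mem_some _) (Part.mem_some _)

theorem TypeTwoComputable.comp_total {F : Baire →. Baire} {Φ : Baire → Baire}
    (hF : TypeTwoComputable F) (hΦ : TotalComputable Φ) :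
    ∃ F' : Baire →. Baire, TypeTwoComputable F' ∧ ∀ p q, q ∈ F (Φ p) → q ∈ F' p := by
  obtain ⟨F', hF', h⟩ := TypeTwoComputable.comp hF hΦ
  exact ⟨F', hF', fun p q => h p _ q (Part.mem_some _)⟩

theorem TypeTwoComputable.total_comp {F : Baire →. Baire} {Φ : Baire → Baire}
    (hΦ : TotalComputable Φ) (hF : TypeTwoComputable F) :
    ∃ F' : Baire →. Baire, TypeTwoComputable F' ∧ ∀ p q, q ∈ F p → Φ q ∈ F' p := by
  obtain ⟨F', hF', h⟩ := TypeTwoComputable.comp hΦ hF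
  exact ⟨F', hF', fun p q hq => h p q _ hq (Part.mem_some _)⟩

/-! ### Evaluation of associates -/

theorem Baire.mem_apply_iff (a q r : Baire) : r ∈ a.apply q ↔
    ∀ n, ∃ m, a (Nat.pair n (Encodable.encode (q.prefix m))) = r n + 1 ∧
      ∀ m' < m, a (Nat.pair n (Encodable.encode (q.prefix m'))) = 0 := by
  constructor
  · rintro ⟨h, rfl⟩ n
    refine ⟨Nat.find (h n), ?_, fun m' hm' => not_not.mp (Nat.find_min (h n) hm')⟩
    have := Nat.find_spec (h n)
    simp only [Baire.apply]
    omega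
  · intro h
    have hd : ∀ n, ∃ m, a (Nat.pair n (Encodable.encode (q.prefix m))) ≠ 0 := fun n => by
      obtain ⟨m, hm, -⟩ := h n
      exact ⟨m, by omega⟩
    refine ⟨hd, funext fun n => ?_⟩
    obtain ⟨m, hm, hm'⟩ := h n
    have : Nat.find (hd n) = m := by
      rw [Nat.find_eq_iff]
      exact ⟨by omega, fun i hi => not_not.mpr (hm' i hi)⟩
    simp only [Baire.apply]
    rw [this, hm, Nat.add_sub_cancel]

/-- Evaluation of associates is computable. -/
theorem exists_typeTwoComputable_apply : ∃ F : Baire →. Baire, TypeTwoComputable F ∧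
    ∀ a q r : Baire, r ∈ a.apply q → r ∈ F (a.pair q) := by
  -- In the pair `⟨a, q⟩` the associate occupies the even positions and its argument the odd ones.
  let idx : List ℕ → ℕ → ℕ → ℕ := fun u n i => 2 * Nat.pair n (Encodable.encode
    ((List.range i).map fun l => u.getD (2 * l + 1) 0))
  -- The first query not known to be answered by 0. It may lie beyond the word read so far; then the
  -- lookup is `none` and nothing is certified.
  let fnd : List ℕ → ℕ → ℕ := fun u n =>
    boundedFind (fun i => !(decide (u[idx u n i]? = some 0))) u.length
  have hw : Computable₂ fun (y : (List ℕ × ℕ) × ℕ) (l : ℕ) => y.1.1.getD (2 * l + 1) 0 :=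
    (Computable.getD_zero (Computable.fst.comp (Computable.fst.comp Computable.fst))
      (Computable.succ.comp (Computable.nat_mul (Computable.const 2) Computable.snd))).to₂
  have hidx : Computable fun y : (List ℕ × ℕ) × ℕ => idx y.1.1 y.1.2 y.2 :=
    Computable.nat_mul (Computable.const 2) (Computable.nat_pair
      (Computable.snd.comp Computable.fst)
      (Computable.encode.comp (Computable.list_map_range Computable.snd hw)))
  have hfnd : Computable₂ fnd := Computable.boundedFind (α := List ℕ × ℕ)
    (f := fun x => x.1.length) (q := fun x i => !(decide (x.1[idx x.1 x.2 i]? = some 0)))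
    (Computable.list_length.comp Computable.fst)
    (Computable.not (Computable.decide_eq (Computable.getElem?
      (Computable.fst.comp Computable.fst) hidx) (Computable.const (some 0)))).to₂
  have hn : Computable fun x : List ℕ × ℕ × ℕ => x.2.1 := Computable.fst.comp Computable.snd
  have hf : Computable fun x : List ℕ × ℕ × ℕ => fnd x.1 x.2.1 :=
    (hfnd.comp Computable.fst hn :)
  have hi : Computable fun x : List ℕ × ℕ × ℕ => idx x.1 x.2.1 (fnd x.1 x.2.1) :=
    (hidx.comp (Computable.pair (Computable.pair Computable.fst hn) hf) :)
  obtain ⟨F, hF, h⟩ := exists_typeTwoComputable_search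
    -- The length test ensures that the queried prefix of `q` has really been read and contains no
    -- default zeros.
    (fun u n m => decide (2 * fnd u n < u.length + 1) &&
      decide (u[idx u n (fnd u n)]? = some (m + 1)))
    (Computable.and (Computable.decide_lt (Computable.nat_mul (Computable.const 2) hf)
      (Computable.succ.comp (Computable.list_length.comp Computable.fst)))
      (Computable.decide_eq (Computable.getElem? Computable.fst hi)
        (Computable.option_some.comp (Computable.succ.comp
          (Computable.snd.comp Computable.snd)))))
  refine ⟨F, hF, fun a q r hr => ?_⟩
  rw [Baire.mem_apply_iff] at hr
  have hidxp : ∀ k n i, 2 * i ≤ k → idx ((a.pair q).prefix k) n i =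
      2 * Nat.pair n (Encodable.encode (q.prefix i)) := by
    intro k n i hik
    have : ((List.range i).map fun l => ((a.pair q).prefix k).getD (2 * l + 1) 0) =
        q.prefix i := by
      refine List.map_congr_left fun l hl => ?_
      have := List.mem_range.mp hl
      rw [Baire.getD_prefix _ (by omega)]
      exact congrFun (Baire.snd_pair a q) l
    simp only [idx]
    rw [this]
  have hpair : ∀ n, (a.pair q) (2 * n) = a n := fun n => congrFun (Baire.fst_pair a q) n
  have hget : ∀ k n i v, 2 * i ≤ k →
      ((a.pair q).prefix k)[idx ((a.pair q).prefix k) n i]? = some v →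
      a (Nat.pair n (Encodable.encode (q.prefix i))) = v := by
    intro k n i v hik hv
    rw [hidxp k n i hik] at hv
    have hlt := (List.getElem?_eq_some_iff.mp hv).1
    rw [Baire.length_prefix] at hlt
    rw [Baire.getElem?_prefix _ hlt, hpair] at hv
    exact Option.some.inj hv
  obtain ⟨r', hr', hv⟩ := h (a.pair q) fun n => by
    obtain ⟨m, hm, hm'⟩ := hr n
    -- Long enough to contain `m` entries of `q` and the answers of `a` to all queries up to the
    -- decisive one.
    set k := 2 * m + 1 + ∑ i ∈ Finset.range (m + 1),
      (2 * Nat.pair n (Encodable.encode (q.prefix i)) + 1) with hk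
    have hlt : ∀ i ≤ m, 2 * Nat.pair n (Encodable.encode (q.prefix i)) < k := by
      intro i hi
      have := Finset.single_le_sum
        (f := fun i => 2 * Nat.pair n (Encodable.encode (q.prefix i)) + 1)
        (fun _ _ => Nat.zero_le _) (Finset.mem_range.mpr (show i < m + 1 by omega))
      omega
    have hval : ∀ i ≤ m, ((a.pair q).prefix k)[idx ((a.pair q).prefix k) n i]? =
        some (a (Nat.pair n (Encodable.encode (q.prefix i)))) := by
      intro i hi
      rw [hidxp k n i (by omega), Baire.getElem?_prefix _ (hlt i hi), hpair]
    have hfind : fnd ((a.pair q).prefix k) n = m := by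
      refine boundedFind_eq (by rw [Baire.length_prefix]; omega) ?_ fun i hi => ?_
      · rw [hval m le_rfl, hm]; simp
      · rw [hval i hi.le, hm' i hi]; simp
    refine ⟨k, r n, ?_⟩
    rw [hfind, hval m le_rfl, hm, Baire.length_prefix]
    simp only [Bool.and_eq_true, decide_eq_true_eq, and_true]
    omega
  have : r' = r := by
    funext n
    obtain ⟨k, hk⟩ := hv n
    simp only [Baire.length_prefix, Bool.and_eq_true, decide_eq_true_eq] at hk
    set j := fnd ((a.pair q).prefix k) n with hj
    obtain ⟨m, hm, hm'⟩ := hr n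
    have h1 := hget k n j _ (by omega) hk.2
    rcases lt_trichotomy j m with h2 | h2 | h2
    · have := hm' j h2
      omega
    · subst h2
      omega
    · have h3 := not_of_lt_boundedFind _ _ _ (show m < fnd ((a.pair q).prefix k) n from h2)
      simp only [Bool.not_eq_false', decide_eq_true_eq] at h3
      have := hget k n m _ (by omega) h3
      omega
  exact this ▸ hr'

/-! ### Compactness of Cantor space -/

/-- The name of a point of Cantor space. -/
def Cantor.toBaire (c : Cantor) : Baire := fun n => (c n).toNat

theorem Cantor.isName_iff (p : Baire) (c : Cantor) :
    RepresentedSpace.IsName p c ↔ p = c.toBaire := funext_iff.symm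

/-- A prefix of length `2 * k` of `⟨s, c⟩` shows only `k` digits of `c`. -/
theorem Cantor.pair_prefix_congr (s : Baire) {c c' : Cantor} {k j : ℕ}
    (h : ∀ l < k, c' l = c l) (hj : j ≤ 2 * k) :
    (s.pair c'.toBaire).prefix j = (s.pair c.toBaire).prefix j := by
  refine Baire.prefix_congr fun i hi => ?_
  by_cases h2 : i % 2 = 0
  · simp [Baire.pair, h2]
  · simp [Baire.pair, h2, Cantor.toBaire, h (i / 2) (by omega)]

/-- A property of points that is eventually true, locally uniformly, is eventually true
uniformly. -/
theorem Cantor.exists_uniform (Q : ℕ → Cantor → Prop)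
    (h : ∀ c : Cantor, ∃ k, ∀ c' : Cantor, (∀ l < k, c' l = c l) → ∀ k' ≥ k, Q k' c') :
    ∃ k, ∀ k' ≥ k, ∀ c, Q k' c := by
  choose κ hκ using h
  have hnhds : ∀ c : Cantor, {c' : Cantor | ∀ l < κ c, c' l = c l} ∈ nhds c := by
    intro c
    have : {c' : Cantor | ∀ l < κ c, c' l = c l} =
        (↑(Finset.range (κ c)) : Set ℕ).pi fun l => {c l} := by
      ext c'; simp [Set.mem_pi]
    rw [this]
    exact set_pi_mem_nhds (Finset.finite_toSet _) fun l _ =>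
      (isOpen_discrete _).mem_nhds (Set.mem_singleton _)
  obtain ⟨t, -, ht⟩ := isCompact_univ.elim_nhds_subcover _ fun c (_ : c ∈ Set.univ) => hnhds c
  -- Finitely many cylinders cover the space. The largest of their thresholds serves all of them,
  -- since each local property persists for all larger `k'`.
  refine ⟨t.sup κ, fun k' hk' c => ?_⟩
  have := ht (Set.mem_univ c)
  simp only [Set.mem_iUnion] at this
  obtain ⟨c₀, hc₀, hc⟩ := this
  exact hκ c₀ c hc k' ((Finset.le_sup hc₀).trans hk')

/-- The numbers below `2 ^ k` run through all binary words of length `k`, which makes quantification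
over Cantor space at finite precision a bounded quantifier. -/
theorem Cantor.exists_testBit_eq (c : Cantor) (k : ℕ) :
    ∃ i < 2 ^ k, ∀ l < k, i.testBit l = c l :=
  ⟨Nat.ofBits fun l : Fin k => c l, Nat.ofBits_lt_two_pow _, fun l hl => by
    rw [Nat.testBit_ofBits_lt _ _ hl]⟩

/-- The word read from `⟨s, c⟩`, where `u` is a prefix of `s` and `c` is the sequence of binary
digits of `i`. -/
def branchWord (u : List ℕ) (i : ℕ) : List ℕ := (List.range (2 * u.length)).map fun n =>
  if n % 2 = 0 then u.getD (n / 2) 0 else i / 2 ^ (n / 2) % 2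

theorem branchWord_computable : Computable₂ branchWord := by
  have h2 : Computable fun x : (List ℕ × ℕ) × ℕ => x.2 / 2 :=
    Computable.nat_div Computable.snd (Computable.const 2)
  refine Computable.list_map_range (α := List ℕ × ℕ) (f := fun x => 2 * x.1.length)
    (g := fun x n => if n % 2 = 0 then x.1.getD (n / 2) 0 else x.2 / 2 ^ (n / 2) % 2)
    (Computable.nat_mul (Computable.const 2) (Computable.list_length.comp Computable.fst)) ?_
  exact (Computable.if_eq (Computable.nat_mod Computable.snd (Computable.const 2))
    (Computable.const 0) (Computable.getD_zero (Computable.fst.comp Computable.fst) h2)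
    (Computable.nat_mod (Computable.nat_div (Computable.snd.comp Computable.fst)
      (Computable.two_pow h2)) (Computable.const 2))).to₂

theorem branchWord_prefix (s : Baire) (k i : ℕ) : branchWord (s.prefix k) i =
    (s.pair (Cantor.toBaire i.testBit)).prefix (2 * k) := by
  rw [branchWord, Baire.length_prefix]
  refine List.map_congr_left fun n hn => ?_
  have hn := List.mem_range.mp hn
  by_cases h : n % 2 = 0
  · simp only [h, if_true, Baire.pair]
    exact s.getD_prefix (by omega)
  · simp only [h, if_false, Baire.pair, Cantor.toBaire, Nat.toNat_testBit]

theorem branchWord_prefix_eq (s : Baire) {k i : ℕ} {c : Cantor}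
    (h : ∀ l < k, i.testBit l = c l) :
    branchWord (s.prefix k) i = (s.pair c.toBaire).prefix (2 * k) := by
  rw [branchWord_prefix]
  exact Cantor.pair_prefix_congr s h le_rfl

/-- Emptiness of a co-c.e. closed subset of Cantor space is semidecidable. -/
theorem exists_computable_isEmpty {E : Baire →. Baire} (hE : TypeTwoComputable E) :
    ∃ V : List ℕ → Bool, Computable V ∧ ∀ (s : Baire) (A : Set Cantor),
      (∀ c : Cantor, ∃ e ∈ E (s.pair c.toBaire), ((∃ n, e n = 0) ↔ c ∉ A)) →
      (A = ∅ → ∃ k, ∀ k' ≥ k, V (s.prefix k') = true) ∧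
      ∀ k, V (s.prefix k) = true → A = ∅ := by
  obtain ⟨h, hc, hm, hE⟩ := hE.exists_approx
  -- Accept once every binary word as long as `u` has been rejected, that is, has made the machine
  -- for `E` write a zero.
  refine ⟨fun u => decide (∀ i < 2 ^ u.length, decide (0 ∈ h (branchWord u i)) = true),
    Computable.forall_lt (Computable.two_pow Computable.list_length)
      (Computable.list_mem (hc.comp branchWord_computable) (Computable.const 0)).to₂,
    fun s A hA => ⟨fun hempty => ?_, fun k hk => ?_⟩⟩
  · obtain ⟨k, hk⟩ := Cantor.exists_uniform
      (fun k c => 0 ∈ h ((s.pair c.toBaire).prefix (2 * k))) fun c => by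
        obtain ⟨e, he, hA⟩ := hA c
        obtain ⟨n, hn⟩ := hA.mpr (by simp [hempty])
        obtain ⟨k, hk⟩ := (hE _ e he n).1
        refine ⟨k, fun c' hc' k' hk' => ?_⟩
        have hk := List.mem_of_getElem? hk
        rw [hn, ← Cantor.pair_prefix_congr s hc' (by omega)] at hk
        exact (hm _ _ _ (by omega)).mem hk
    refine ⟨k, fun k' hk' => ?_⟩
    simp only [decide_eq_true_eq]
    intro i _
    rw [branchWord_prefix]
    exact hk k' hk' _
  · simp only [decide_eq_true_eq, Baire.length_prefix] at hk
    refine Set.eq_empty_of_forall_notMem fun c => ?_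
    obtain ⟨e, he, hA⟩ := hA c
    obtain ⟨i, hi, hic⟩ := c.exists_testBit_eq k
    have h0 := hk i hi
    rw [branchWord_prefix_eq s hic] at h0
    obtain ⟨n, hn⟩ := List.mem_iff_getElem?.mp h0
    exact hA.mp ⟨n, (hE _ e he n).2 _ _ hn⟩

/-! ### Compact choice for single-valued problems -/

/-- Clearing denominators turns the comparison into one of natural numbers, without subtraction. -/
theorem ratNumbering_lt_iff (e N : ℕ) : (ratNumbering e : ℝ) < 3 * (2 : ℝ)⁻¹ ^ N ↔
    e.unpair.1.unpair.1 * 2 ^ N < 3 * (e.unpair.2 + 1) + e.unpair.1.unpair.2 * 2 ^ N := by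
  have h1 : (0 : ℝ) < (e.unpair.2 : ℝ) + 1 := by positivity
  have h2 : (0 : ℝ) < (2 : ℝ) ^ N := by positivity
  simp only [ratNumbering]
  push_cast
  rw [inv_pow, ← div_eq_mul_inv, div_lt_div_iff₀ h1 h2, sub_mul, sub_lt_iff_lt_add]
  exact_mod_cast Iff.rfl

/-- Closeness of points of the dense subset is decidable up to a constant factor. -/
theorem exists_computable_close (Y : Type*) [MetricSpace Y] [ComputableMetricSpace Y] :
    ∃ close : ℕ → ℕ → ℕ → Bool, (Computable fun x : ℕ × ℕ × ℕ => close x.1 x.2.1 x.2.2) ∧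
      ∀ i j N, (dist (ComputableMetricSpace.numbering i : Y) (ComputableMetricSpace.numbering j) ≤
          2 * (2 : ℝ)⁻¹ ^ N → close i j N = true) ∧
        (close i j N = true → dist (ComputableMetricSpace.numbering i : Y)
          (ComputableMetricSpace.numbering j) < 4 * (2 : ℝ)⁻¹ ^ N) := by
  obtain ⟨c, hc, hd⟩ := ComputableMetricSpace.dist_computable (X := Y)
  have hN : Computable fun x : ℕ × ℕ × ℕ => 2 ^ x.2.2 :=
    Computable.two_pow (Computable.snd.comp Computable.snd)
  -- The threshold 3 lies between 2 and 4 with a margin of 1 on either side, which absorbs the error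
  -- `2⁻ᴺ` of the approximate distance.
  refine ⟨fun i j N => decide ((c (i, j, N)).unpair.1.unpair.1 * 2 ^ N <
      3 * ((c (i, j, N)).unpair.2 + 1) + (c (i, j, N)).unpair.1.unpair.2 * 2 ^ N),
    Computable.decide_lt (Computable.nat_mul (Computable.unpair_fst (Computable.unpair_fst hc)) hN)
      (Computable.nat_add (Computable.nat_mul (Computable.const 3)
        (Computable.succ.comp (Computable.unpair_snd hc)))
        (Computable.nat_mul (Computable.unpair_snd (Computable.unpair_fst hc)) hN)),
    fun i j N => ?_⟩
  have h := abs_lt.mp (hd i j N)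
  rw [decide_eq_true_eq, ← ratNumbering_lt_iff]
  constructor <;> intro h' <;> linarith

theorem dist_le_of_isName {Y : Type*} [MetricSpace Y] [ComputableMetricSpace Y] {q : Baire}
    {y : Y} (h : RepresentedSpace.IsName q y) (n : ℕ) :
    dist y (ComputableMetricSpace.numbering (q n)) ≤ (2 : ℝ)⁻¹ ^ n :=
  le_of_tendsto (h.2.dist tendsto_const_nhds)
    (Filter.eventually_atTop.mpr ⟨n + 1, fun i hi => (h.1 i n (by omega)).le⟩)

/-- Here 5 is the closeness bound 4 plus the error 1 of a name, in units of `2⁻¹ ^ (n + 4)`. Two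
such errors give 10 < 16, hence the strict inequality required of names; this explains the shift by
4. -/
theorem isName_of_dist_le {Y : Type*} [MetricSpace Y] [ComputableMetricSpace Y] {q : Baire}
    {y : Y} (h : ∀ n, dist y (ComputableMetricSpace.numbering (q n)) ≤ 5 * (2 : ℝ)⁻¹ ^ (n + 4)) :
    RepresentedSpace.IsName q y := by
  refine ⟨fun i j hij => ?_, ?_⟩
  · have h1 := dist_triangle_left (ComputableMetricSpace.numbering (q i) : Y)
      (ComputableMetricSpace.numbering (q j)) y
    have h2 : (2 : ℝ)⁻¹ ^ (i + 4) ≤ (2 : ℝ)⁻¹ ^ (j + 4) :=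
      pow_le_pow_of_le_one (by norm_num) (by norm_num) (by omega)
    have h3 : (2 : ℝ)⁻¹ ^ j = 16 * (2 : ℝ)⁻¹ ^ (j + 4) := by
      rw [pow_add, inv_pow 2 4]; ring
    have h4 : (0 : ℝ) < (2 : ℝ)⁻¹ ^ (j + 4) := by positivity
    linarith [h i, h j]
  · rw [tendsto_iff_dist_tendsto_zero]
    have := ((tendsto_pow_atTop_nhds_zero_of_lt_one (r := (2 : ℝ)⁻¹) (by norm_num)
      (by norm_num)).comp (Filter.tendsto_add_atTop_nat 4)).const_mul 5
    rw [mul_zero] at this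
    refine squeeze_zero (fun _ => dist_nonneg) (fun n => ?_) this
    rw [dist_comm]
    exact h n

/-- If every point of a nonempty co-c.e. closed subset of Cantor space leads to the same point
of a computable metric space, then this point is computable without choosing. -/
theorem exists_typeTwoComputable_of_compact (Y : Type*) [MetricSpace Y] [ComputableMetricSpace Y]
    {E K : Baire →. Baire} (hE : TypeTwoComputable E) (hK : TypeTwoComputable K) :
    ∃ F : Baire →. Baire, TypeTwoComputable F ∧ ∀ (s : Baire) (A : Set Cantor) (y : Y),
      A.Nonempty → (∀ c : Cantor, ∃ e ∈ E (s.pair c.toBaire), ((∃ n, e n = 0) ↔ c ∉ A)) →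
      (∀ c ∈ A, ∃ q ∈ K (s.pair c.toBaire), RepresentedSpace.IsName q y) →
      ∃ q ∈ F s, RepresentedSpace.IsName q y := by
  obtain ⟨h, hc, hm, hE⟩ := hE.exists_approx
  obtain ⟨g, gc, gm, hK⟩ := hK.exists_approx
  obtain ⟨close, closec, hclose⟩ := exists_computable_close Y
  -- The default `false` makes a word that is neither rejected nor has produced its output count as
  -- not yet good.
  let good : List ℕ → ℕ → ℕ → Bool := fun w n m => decide (0 ∈ h w) ||
    ((g w)[n + 4]?.map fun m' => close m m' (n + 4)).getD false
  have hn : Computable fun x : List ℕ × ℕ × ℕ => x.2.1 + 4 :=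
    Computable.nat_add (Computable.fst.comp Computable.snd) (Computable.const 4)
  have hgood : Computable fun x : List ℕ × ℕ × ℕ => good x.1 x.2.1 x.2.2 := by
    refine Computable.or (Computable.list_mem (hc.comp Computable.fst) (Computable.const 0))
      (Computable.option_getD (Computable.option_map
        (Computable.getElem? (gc.comp Computable.fst) hn) ?_) (Computable.const false))
    exact (closec.comp (Computable.pair
      (Computable.snd.comp (Computable.snd.comp Computable.fst)) (Computable.pair
      Computable.snd (hn.comp Computable.fst))) :)
  have hgood' : Computable fun y : (List ℕ × ℕ × ℕ) × ℕ =>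
      good (branchWord y.1.1 y.2) y.1.2.1 y.1.2.2 :=
    (hgood.comp (Computable.pair (branchWord_computable.comp
      (Computable.fst.comp Computable.fst) Computable.snd)
      (Computable.snd.comp Computable.fst)) :)
  obtain ⟨F, hF, hFs⟩ := exists_typeTwoComputable_search
    (fun u n m => decide (∀ i < 2 ^ u.length, good (branchWord u i) n m = true))
    (Computable.forall_lt (Computable.two_pow (Computable.list_length.comp Computable.fst))
      hgood'.to₂)
  refine ⟨F, hF, fun s A y ⟨c₀, hc₀⟩ hA hy => ?_⟩
  obtain ⟨q, hq, hv⟩ := hFs s fun n => by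
    -- The search succeeds with an entry of the name obtained from `c₀`: entries `n + 4` of two
    -- names of `y` are at most `2 * 2⁻¹ ^ (n + 4)` apart, so they pass the test.
    obtain ⟨q₀, -, hname₀⟩ := hy c₀ hc₀
    obtain ⟨k, hk⟩ := Cantor.exists_uniform
      (fun k c => good ((s.pair c.toBaire).prefix (2 * k)) n (q₀ (n + 4)) = true) fun c => by
        obtain ⟨e, he, hAe⟩ := hA c
        by_cases hcA : c ∈ A
        · obtain ⟨q, hq, hname⟩ := hy c hcA
          obtain ⟨k, hk⟩ := (hK _ q hq (n + 4)).1
          refine ⟨k, fun c' hc' k' hk' => ?_⟩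
          rw [← Cantor.pair_prefix_congr s hc' (by omega)] at hk
          have hk := (gm _ _ (2 * k') (by omega)).getElem?_eq_some hk
          have hdist := dist_triangle_left
            (ComputableMetricSpace.numbering (q₀ (n + 4)) : Y)
            (ComputableMetricSpace.numbering (q (n + 4))) y
          have h1 := dist_le_of_isName hname₀ (n + 4)
          have h2 := dist_le_of_isName hname (n + 4)
          have h3 := (hclose (q₀ (n + 4)) (q (n + 4)) (n + 4)).1 (by linarith)
          simp [good, hk, h3]
        · obtain ⟨l, hl⟩ := hAe.mpr hcA
          obtain ⟨k, hk⟩ := (hE _ e he l).1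
          refine ⟨k, fun c' hc' k' hk' => ?_⟩
          have hk := List.mem_of_getElem? hk
          rw [hl, ← Cantor.pair_prefix_congr s hc' (by omega)] at hk
          simp [good, (hm _ _ (2 * k') (by omega)).mem hk]
    refine ⟨k, q₀ (n + 4), ?_⟩
    simp only [decide_eq_true_eq]
    intro i _
    rw [branchWord_prefix]
    exact hk k le_rfl _
  refine ⟨q, hq, isName_of_dist_le fun n => ?_⟩
  obtain ⟨k, hk⟩ := hv n
  simp only [decide_eq_true_eq, Baire.length_prefix] at hk
  -- Whatever value was found, the branch of `c₀` was among those tested, and it cannot have been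
  -- rejected.
  obtain ⟨i, hi, hic⟩ := c₀.exists_testBit_eq k
  have h0 := hk i hi
  rw [branchWord_prefix_eq s hic] at h0
  obtain ⟨e, he, hAe⟩ := hA c₀
  obtain ⟨q₀, hq₀, hname₀⟩ := hy c₀ hc₀
  have hrej : 0 ∉ h ((s.pair c₀.toBaire).prefix (2 * k)) := by
    intro hmem
    obtain ⟨l, hl⟩ := List.mem_iff_getElem?.mp hmem
    exact hAe.mp ⟨l, (hE _ e he l).2 _ _ hl⟩ hc₀
  simp only [good, hrej, decide_false, Bool.false_or] at h0
  cases hval : (g ((s.pair c₀.toBaire).prefix (2 * k)))[n + 4]? with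
  | none => simp [hval] at h0
  | some m' =>
    simp only [hval, Option.map_some, Option.getD_some] at h0
    have h1 := (hK _ q₀ hq₀ (n + 4)).2 _ _ hval
    have h2 := (hclose _ _ _).2 h0
    have h3 := dist_le_of_isName hname₀ (n + 4)
    rw [h1] at h3
    have h4 := dist_triangle_right y (ComputableMetricSpace.numbering (q n) : Y)
      (ComputableMetricSpace.numbering m')
    linarith

/-! ### Using a reduction -/

/-- What a reduction of `f` to `g` says about a name of a point of the domain of `f`. -/
theorem exists_instance_of_realizes {X Y U V : Type*} [RepresentedSpace X] [RepresentedSpace Y]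
    [RepresentedSpace U] [RepresentedSpace V] {f : MultiMap X Y} {g : MultiMap U V}
    {K H : Baire →. Baire}
    (h : ∀ G : Baire →. Baire, Realizes G g →
      Realizes (fun p => (H p).bind fun q => (G q).bind fun r => K (p.pair r)) f)
    {p : Baire} {x : X} (hp : RepresentedSpace.IsName p x) (hx : (f x).Nonempty) :
    ∃ a ∈ H p, ∃ u, RepresentedSpace.IsName a u ∧ (g u).Nonempty ∧
      ∀ v ∈ g u, ∀ r, RepresentedSpace.IsName r v →
        ∃ q ∈ K (p.pair r), ∃ y ∈ f x, RepresentedSpace.IsName q y := by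
  classical
  let Good : Baire → Baire → Prop := fun q r =>
    ∃ u, RepresentedSpace.IsName q u ∧ ∃ v ∈ g u, RepresentedSpace.IsName r v
  let G : Baire →. Baire := fun q => ⟨∃ r, Good q r, fun H => H.choose⟩
  have hG : Realizes G g := by
    rintro q u hq ⟨v, hv⟩
    obtain ⟨r, hr⟩ := RepresentedSpace.exists_name v
    have hd : ∃ r, Good q r := ⟨r, u, hq, v, hv, hr⟩
    obtain ⟨u', hu', v', hv', hr'⟩ := hd.choose_spec
    obtain rfl := RepresentedSpace.unique hq hu'
    exact ⟨_, ⟨hd, rfl⟩, v', hv', hr'⟩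
  -- `G` is undefined off the names of solvable instances, so the mere convergence of the composite
  -- shows that `a` names such an instance.
  obtain ⟨q, hq, -⟩ := h G hG p x hp hx
  simp only [Part.mem_bind_iff] at hq
  obtain ⟨a, ha, r₀, ⟨⟨r₁, u, hau, v₁, hv₁, -⟩, -⟩, -⟩ := hq
  refine ⟨a, ha, u, hau, ⟨v₁, hv₁⟩, fun v hv r hr => ?_⟩
  -- Changing the realizer at the single input `a` lets it return any prescribed name of a solution.
  let G' : Baire →. Baire := fun q => if q = a then Part.some r else G q
  have hG' : Realizes G' g := by
    intro q u' hq hne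
    by_cases hqa : q = a
    · subst hqa
      obtain rfl := RepresentedSpace.unique hau hq
      exact ⟨r, by simp [G'], v, hv, hr⟩
    · simpa only [G', hqa, if_false] using hG q u' hq hne
  obtain ⟨q, hq, hy⟩ := h G' hG' p x hp hx
  simp only [Part.mem_bind_iff] at hq
  obtain ⟨a', ha', r', hr', hq⟩ := hq
  obtain rfl := Part.mem_unique ha ha'
  simp only [G', if_true, Part.mem_some_iff] at hr'
  subst hr'
  exact ⟨q, hq, hy⟩

/-- A name of a closed set rejects exactly the names of the points of its complement. -/
theorem exists_mem_apply_of_isName {X : Type*} [RepresentedSpace X] {a t : Baire}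
    {A : ClosedSet X} {x : X} (ha : RepresentedSpace.IsName a A)
    (ht : RepresentedSpace.IsName t x) :
    ∃ e ∈ a.apply t, ((∃ n, e n = 0) ↔ x ∉ A.1) := by
  obtain ⟨e, he, y, hy, hey⟩ := ha t x ht (Set.singleton_nonempty _)
  refine ⟨e, he, ?_⟩
  have h1 : y = (x ∉ A.1 : Prop) := hy
  have h2 : y = (∃ n, e n = 0 : Prop) := hey
  exact iff_of_eq (h2.symm.trans h1)

/-- Evaluation of computed associates at computed points is computable. -/
theorem TypeTwoComputable.exists_apply {H : Baire →. Baire} {Φ Θ Ψ : Baire → Baire}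
    (hH : TypeTwoComputable H) (hΦ : TotalComputable Φ) (hΘ : TotalComputable Θ)
    (hΨ : TotalComputable Ψ) : ∃ E : Baire →. Baire, TypeTwoComputable E ∧
      ∀ z a e, a ∈ H (Φ z) → e ∈ (Θ a).apply (Ψ z) → e ∈ E z := by
  obtain ⟨F₁, hF₁, h₁⟩ := hH.comp_total hΦ
  obtain ⟨F₂, hF₂, h₂⟩ := TypeTwoComputable.total_comp hΘ hF₁
  obtain ⟨F₃, hF₃, h₃⟩ := TypeTwoComputable.pair hF₂ hΨ
  obtain ⟨A, hA, h₄⟩ := exists_typeTwoComputable_apply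
  obtain ⟨E, hE, h₅⟩ := TypeTwoComputable.comp hA hF₃
  exact ⟨E, hE, fun z a e ha he => h₅ z _ e
    (h₃ z _ _ (h₂ z a (h₁ z a ha)) (Part.mem_some _)) (h₄ _ _ _ he)⟩

theorem TotalComputable.id : TotalComputable fun p => p :=
  TotalComputable.of_modulus (ψ := fun u n => u.getD n 0) (b := fun n => n + 1)
    (Computable.getD_zero Computable.fst Computable.snd).to₂ Computable.succ
    fun p _ => (p.getD_prefix (Nat.lt_succ_self _)).symm

section

variable {X : Type*} [RepresentedSpace X] {Y : Type*} [MetricSpace Y] [ComputableMetricSpace Y]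

/-- Compact choice as a factor does not help to compute single-valued functions into computable
metric spaces. -/
theorem weihrauchLE_of_le_cantor_prod (f : X →. Y) {U V : Type*} [RepresentedSpace U]
    [RepresentedSpace V] (g : MultiMap U V)
    (h : f.toMultiMap ≤W (closedChoice Cantor).prod g) : f.toMultiMap ≤W g := by
  obtain ⟨K, H, hK, hH, hKH⟩ := h
  -- The machines below read `⟨⟨p, r⟩, c⟩`: the given name, the answer for `g`, and a candidate
  -- point of Cantor space.
  have hff := TotalComputable.fst.comp TotalComputable.fst
  obtain ⟨E, hE, hEs⟩ := hH.exists_apply hff TotalComputable.fst TotalComputable.snd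
  obtain ⟨K', hK', hKs⟩ := hK.comp_total (hff.pair
    (TotalComputable.snd.pair (TotalComputable.snd.comp TotalComputable.fst)))
  obtain ⟨F, hF, hFs⟩ := exists_typeTwoComputable_of_compact Y hE hK'
  obtain ⟨H', hH', hHs⟩ := TypeTwoComputable.total_comp TotalComputable.snd hH
  refine ⟨F, H', hF, hH', fun G hG p x hp hx => ?_⟩
  obtain ⟨a, ha, ⟨A, u⟩, ⟨haA, hau⟩, ⟨⟨c₁, v₁⟩, hc₁, hv₁⟩, hq⟩ :=
    exists_instance_of_realizes hKH hp hx
  obtain ⟨y, hy⟩ := hx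
  obtain ⟨r, hr, v, hv, hrv⟩ := hG a.snd u hau ⟨v₁, hv₁⟩
  obtain ⟨q, hq, hqy⟩ := hFs (p.pair r) A.1 y ⟨c₁, hc₁⟩ (fun c => by
    obtain ⟨e, he, hec⟩ := exists_mem_apply_of_isName haA ((Cantor.isName_iff _ c).mpr rfl)
    refine ⟨e, hEs _ a e ?_ ?_, hec⟩
    · rwa [Baire.fst_pair, Baire.fst_pair]
    · rwa [Baire.snd_pair]) fun c hc => by
    -- The same `v` is combined with every `c`; single-valuedness of `f` then makes all results
    -- names of the same `y`.
    obtain ⟨q, hq, y', hy', hqy⟩ := hq (c, v) ⟨hc, hv⟩ (c.toBaire.pair r)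
      ⟨by rw [Baire.fst_pair]; exact (Cantor.isName_iff _ c).mpr rfl, by rwa [Baire.snd_pair]⟩
    refine ⟨q, hKs _ q ?_, Part.mem_unique hy' hy ▸ hqy⟩
    simpa only [Baire.fst_pair, Baire.snd_pair] using hq
  refine ⟨q, ?_, y, hy, hqy⟩
  simp only [Part.mem_bind_iff]
  exact ⟨a.snd, hHs p a ha, r, hr, hq⟩

/-- Single-valued functions into computable metric spaces that are reducible to compact choice
are computable. -/
theorem isComputable_of_le_cantor (f : X →. Y) (h : f.toMultiMap ≤W closedChoice Cantor) :
    f.toMultiMap.IsComputable := by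
  obtain ⟨K, H, hK, hH, hKH⟩ := h
  obtain ⟨E, hE, hEs⟩ := hH.exists_apply TotalComputable.fst TotalComputable.id
    TotalComputable.snd
  obtain ⟨F, hF, hFs⟩ := exists_typeTwoComputable_of_compact Y hE hK
  refine ⟨F, hF, fun p x hp hx => ?_⟩
  obtain ⟨a, ha, A, haA, hne, hq⟩ := exists_instance_of_realizes hKH hp hx
  obtain ⟨y, hy⟩ := hx
  obtain ⟨q, hq, hqy⟩ := hFs p A.1 y hne (fun c => by
    obtain ⟨e, he, hec⟩ := exists_mem_apply_of_isName haA ((Cantor.isName_iff _ c).mpr rfl)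
    refine ⟨e, hEs _ a e ?_ ?_, hec⟩
    · rwa [Baire.fst_pair]
    · rwa [Baire.snd_pair]) fun c hc => by
    obtain ⟨q, hq, y', hy', hqy⟩ := hq c hc c.toBaire ((Cantor.isName_iff _ c).mpr rfl)
    exact ⟨q, hq, Part.mem_unique hy' hy ▸ hqy⟩
  exact ⟨q, hq, y, hy, hqy⟩

end

/-! ### Binary expansions of real numbers -/

/-- The natural number with the given binary digits, the most significant first. -/
def binaryValue (w : List ℕ) : ℕ := w.foldl (fun s d => 2 * s + d) 0

theorem binaryValue_computable : Computable binaryValue :=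
  (Primrec.list_foldl (f := fun w : List ℕ => w) (g := fun _ => 0)
    (h := fun _ x => 2 * x.1 + x.2) Primrec.id (Primrec.const 0)
    (Primrec.nat_add.comp (Primrec.nat_mul.comp (Primrec.const 2)
      (Primrec.fst.comp Primrec.snd)) (Primrec.snd.comp Primrec.snd)).to₂).to_comp

theorem binaryValue_prefix_succ (p : Baire) (i : ℕ) :
    binaryValue (p.prefix (i + 1)) = 2 * binaryValue (p.prefix i) + p i := by
  simp [binaryValue, Baire.prefix, List.range_succ]

/-- A code of the sum of the rational number with code `e` and `b / 2 ^ i`. -/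
def addDyadicCode (e b i : ℕ) : ℕ :=
  Nat.pair (Nat.pair (e.unpair.1.unpair.1 * 2 ^ i + b * (e.unpair.2 + 1))
    (e.unpair.1.unpair.2 * 2 ^ i)) ((e.unpair.2 + 1) * 2 ^ i - 1)

theorem ratNumbering_addDyadicCode (e b i : ℕ) :
    (ratNumbering (addDyadicCode e b i) : ℝ) = ratNumbering e + b * (2 : ℝ)⁻¹ ^ i := by
  have h1 : (((e.unpair.2 + 1) * 2 ^ i - 1 : ℕ) : ℝ) + 1 = ((e.unpair.2 : ℝ) + 1) * 2 ^ i := by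
    have : (e.unpair.2 + 1) * 2 ^ i - 1 + 1 = (e.unpair.2 + 1) * 2 ^ i :=
      Nat.sub_add_cancel (Nat.mul_pos (by omega) (by positivity))
    exact_mod_cast this
  have h2 : (0 : ℝ) < (e.unpair.2 : ℝ) + 1 := by positivity
  simp only [ratNumbering, addDyadicCode, Nat.unpair_pair]
  push_cast
  rw [h1, inv_pow]
  field_simp
  ring

/-- From a pair of a name of a natural number `n` and a binary sequence, a name of the sum of the
`n`-th rational number and the real number in `[0, 1]` with this binary expansion. -/
def realName (z : Baire) : Baire := fun i =>
  addDyadicCode (z 0) (binaryValue (z.snd.prefix i)) i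

theorem realName_totalComputable : TotalComputable realName := by
  have hu : Computable fun x : List ℕ × ℕ => x.1.getD 0 0 :=
    Computable.getD_zero Computable.fst (Computable.const 0)
  have hw : Computable fun x : List ℕ × ℕ =>
      binaryValue ((List.range x.2).map fun l => x.1.getD (2 * l + 1) 0) :=
    binaryValue_computable.comp (Computable.list_map_range Computable.snd
      (Computable.getD_zero (Computable.fst.comp Computable.fst)
        (Computable.succ.comp (Computable.nat_mul (Computable.const 2) Computable.snd))).to₂)
  have hp : Computable fun x : List ℕ × ℕ => 2 ^ x.2 := Computable.two_pow Computable.snd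
  have hd : Computable fun x : List ℕ × ℕ => (x.1.getD 0 0).unpair.2 + 1 :=
    Computable.succ.comp (Computable.unpair_snd hu)
  refine TotalComputable.of_modulus (ψ := fun u i => addDyadicCode (u.getD 0 0)
      (binaryValue ((List.range i).map fun l => u.getD (2 * l + 1) 0)) i)
    (b := fun i => 2 * i + 1) ?_
    (Computable.succ.comp (Computable.nat_mul (Computable.const 2) Computable.id)) fun z i => ?_
  · exact (Computable.nat_pair (Computable.nat_pair
      (Computable.nat_add (Computable.nat_mul (Computable.unpair_fst (Computable.unpair_fst hu)) hp)
        (Computable.nat_mul hw hd))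
      (Computable.nat_mul (Computable.unpair_snd (Computable.unpair_fst hu)) hp))
      (Computable.nat_sub (Computable.nat_mul hd hp) (Computable.const 1))).to₂
  · have : ((List.range i).map fun l => (z.prefix (2 * i + 1)).getD (2 * l + 1) 0) =
        z.snd.prefix i := by
      refine List.map_congr_left fun l hl => ?_
      have := List.mem_range.mp hl
      exact z.getD_prefix (by omega)
    rw [this, z.getD_prefix (by omega), realName]

/-- Only the first entry of a name of a natural number matters, so an oracle answer may be exchanged
for a constant sequence. -/
theorem realName_congr {r r' q : Baire} (h : r 0 = r' 0) :
    realName (r.pair q) = realName (r'.pair q) := by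
  funext i
  simp only [realName, Baire.snd_pair]
  have : (r.pair q) 0 = (r'.pair q) 0 := h
  rw [this]

theorem numbering_realName (r : Baire) (c : Cantor) (i : ℕ) :
    (ComputableMetricSpace.numbering (realName (r.pair c.toBaire) i) : ℝ) =
      ratNumbering (r 0) + binaryValue (c.toBaire.prefix i) * (2 : ℝ)⁻¹ ^ i := by
  have h : realName (r.pair c.toBaire) i =
      addDyadicCode (r 0) (binaryValue (c.toBaire.prefix i)) i := by
    rw [realName, Baire.snd_pair]; rfl
  rw [h, ← ratNumbering_addDyadicCode]
  rfl

/-- The `k` digits after the first `j` contribute at most a geometric sum. Its exact value is kept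
because the subtracted term gives the strict inequality in the Cauchy representation. -/
theorem binaryValue_sub_bounds (c : Cantor) (j k : ℕ) :
    0 ≤ binaryValue (c.toBaire.prefix (j + k)) * (2 : ℝ)⁻¹ ^ (j + k) -
      binaryValue (c.toBaire.prefix j) * (2 : ℝ)⁻¹ ^ j ∧
    binaryValue (c.toBaire.prefix (j + k)) * (2 : ℝ)⁻¹ ^ (j + k) -
      binaryValue (c.toBaire.prefix j) * (2 : ℝ)⁻¹ ^ j ≤ (2 : ℝ)⁻¹ ^ j - (2 : ℝ)⁻¹ ^ (j + k) := by
  induction k with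
  | zero => simp
  | succ k ih =>
    have hc : (0 : ℝ) ≤ c.toBaire (j + k) ∧ (c.toBaire (j + k) : ℝ) ≤ 1 := by
      refine ⟨Nat.cast_nonneg _, ?_⟩
      exact_mod_cast Bool.toNat_le (c (j + k))
    have hp : (0 : ℝ) < (2 : ℝ)⁻¹ ^ (j + k + 1) := by positivity
    have h1 : (2 : ℝ)⁻¹ ^ (j + k) = 2 * (2 : ℝ)⁻¹ ^ (j + k + 1) := by rw [pow_succ]; ring
    rw [← add_assoc, binaryValue_prefix_succ]
    push_cast
    rw [h1] at ih
    constructor <;> nlinarith [mul_nonneg hc.1 hp.le, mul_le_mul_of_nonneg_right hc.2 hp.le]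

theorem realName_fast (r : Baire) (c : Cantor) (i j : ℕ) (hij : j < i) :
    dist (ComputableMetricSpace.numbering (realName (r.pair c.toBaire) i) : ℝ)
      (ComputableMetricSpace.numbering (realName (r.pair c.toBaire) j)) < (2 : ℝ)⁻¹ ^ j := by
  obtain ⟨k, rfl⟩ := Nat.exists_eq_add_of_lt hij
  have h := binaryValue_sub_bounds c j (k + 1)
  rw [← add_assoc] at h
  have hp : (0 : ℝ) < (2 : ℝ)⁻¹ ^ (j + k + 1) := by positivity
  rw [numbering_realName, numbering_realName, Real.dist_eq, add_sub_add_left_eq_sub,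
    abs_of_nonneg h.1]
  linarith [h.2]

/-- Every digit sequence names some real number, so membership in a closed set of reals can be
tested on all of Cantor space. -/
theorem exists_isName_realName (r : Baire) (c : Cantor) :
    ∃ x : ℝ, RepresentedSpace.IsName (realName (r.pair c.toBaire)) x := by
  have : CauchySeq fun i =>
      (ComputableMetricSpace.numbering (realName (r.pair c.toBaire) i) : ℝ) := by
    refine cauchySeq_of_le_geometric (2 : ℝ)⁻¹ 1 (by norm_num) fun n => ?_
    rw [dist_comm, one_mul]
    exact (realName_fast r c (n + 1) n (Nat.lt_succ_self n)).le
  obtain ⟨x, hx⟩ := cauchySeq_tendsto_of_complete this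
  exact ⟨x, realName_fast r c, hx⟩

/-- Every real number has an integer part and a binary expansion. -/
theorem exists_realName_isName (x : ℝ) : ∃ (n : ℕ) (c : Cantor),
    RepresentedSpace.IsName (realName (Baire.pair (fun _ => n) c.toBaire)) x := by
  obtain ⟨n, hn⟩ := ratNumbering_surjective (⌊x⌋ : ℚ)
  have ht0 := Int.fract_nonneg x
  have ht1 := Int.fract_lt_one x
  set t := Int.fract x with ht
  -- With these digits the first `i` of them have the value `⌊t * 2 ^ i⌋`.
  let c : Cantor := fun l => decide (⌊t * 2 ^ (l + 1)⌋₊ % 2 = 1)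
  have hB : ∀ i, binaryValue (c.toBaire.prefix i) = ⌊t * 2 ^ i⌋₊ := by
    intro i
    induction i with
    | zero =>
      have : ⌊t * 2 ^ 0⌋₊ = 0 := by
        rw [pow_zero, mul_one]; exact Nat.floor_eq_zero.mpr ht1
      rw [this]; rfl
    | succ i ih =>
      have h1 : ⌊t * 2 ^ i⌋₊ = ⌊t * 2 ^ (i + 1)⌋₊ / 2 := by
        rw [← Nat.floor_div_ofNat, pow_succ]
        congr 1
        simp [← mul_assoc]
      have h2 : c.toBaire i = ⌊t * 2 ^ (i + 1)⌋₊ % 2 := by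
        rcases Nat.mod_two_eq_zero_or_one ⌊t * 2 ^ (i + 1)⌋₊ with h | h <;>
          simp [Cantor.toBaire, c, h]
      rw [binaryValue_prefix_succ, ih, h1, h2]
      exact Nat.div_add_mod _ 2
  refine ⟨n, c, realName_fast _ c, ?_⟩
  rw [tendsto_iff_dist_tendsto_zero]
  refine squeeze_zero (fun _ => dist_nonneg) (fun i => ?_)
    (tendsto_pow_atTop_nhds_zero_of_lt_one (r := (2 : ℝ)⁻¹) (by norm_num) (by norm_num))
  have hp : (0 : ℝ) < (2 : ℝ) ^ i := by positivity
  have h1 : t * 2 ^ i * (2 : ℝ)⁻¹ ^ i = t := by rw [inv_pow]; field_simp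
  have hp' : (0 : ℝ) < (2 : ℝ)⁻¹ ^ i := by positivity
  have h2 := Nat.floor_le (mul_nonneg ht0 hp.le)
  have h3 := Nat.lt_floor_add_one (t * 2 ^ i)
  have h4 : x = ⌊x⌋ + t := (Int.floor_add_fract x).symm
  rw [numbering_realName, hB, hn, Real.dist_eq, abs_le, Rat.cast_intCast]
  constructor <;> nlinarith [mul_le_mul_of_nonneg_right h2 hp'.le,
    mul_le_mul_of_nonneg_right h3.le hp'.le]

/-! ### Names of closed sets of natural numbers -/

/-- The word read from `⟨p, n, n, n, …⟩`, where `u` is a prefix of `p`. -/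
def constWord (u : List ℕ) (n : ℕ) : List ℕ := (List.range (2 * u.length)).map fun i =>
  if i % 2 = 0 then u.getD (i / 2) 0 else n

theorem constWord_computable : Computable₂ constWord := by
  refine Computable.list_map_range (α := List ℕ × ℕ) (f := fun x => 2 * x.1.length)
    (g := fun x i => if i % 2 = 0 then x.1.getD (i / 2) 0 else x.2)
    (Computable.nat_mul (Computable.const 2) (Computable.list_length.comp Computable.fst)) ?_
  exact (Computable.if_eq (Computable.nat_mod Computable.snd (Computable.const 2))
    (Computable.const 0) (Computable.getD_zero (Computable.fst.comp Computable.fst)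
      (Computable.nat_div Computable.snd (Computable.const 2)))
    (Computable.snd.comp Computable.fst)).to₂

theorem constWord_prefix (p : Baire) (k n : ℕ) :
    constWord (p.prefix k) n = (p.pair fun _ => n).prefix (2 * k) := by
  rw [constWord, Baire.length_prefix]
  refine List.map_congr_left fun i hi => ?_
  have hi := List.mem_range.mp hi
  by_cases h : i % 2 = 0
  · simp only [h, if_true, Baire.pair]
    exact p.getD_prefix (by omega)
  · simp only [h, if_false, Baire.pair]

/-- A semidecidable set of natural numbers has a computable name as an open set. -/
theorem exists_totalComputable_rejecting {V : List ℕ → Bool} (hV : Computable V) :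
    ∃ Φ : Baire → Baire, TotalComputable Φ ∧ ∀ p q : Baire, ∃ e ∈ (Φ p).apply q,
      ((∃ j, e j = 0) ↔ ∃ j, V ((p.pair fun _ => q 0).prefix (2 * j)) = true) := by
  -- Associates store the output plus one: 0 asks for more input (the word is still empty), 1 writes
  -- the zero that signals rejection, and 2 writes a one.
  let ψ : List ℕ → ℕ → ℕ := fun u m =>
    (((Encodable.decode (α := List ℕ) m.unpair.2).bind List.head?).map fun n =>
      bif V (constWord u n) then 1 else 2).getD 0
  have hψ : Computable₂ ψ := by
    refine Computable.option_getD (Computable.option_map (Computable.option_bind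
      (Computable.decode.comp (Computable.unpair_snd Computable.snd))
      (Primrec.list_head?.to_comp.comp Computable.snd).to₂) ?_) (Computable.const 0)
    exact (Computable.cond (hV.comp (constWord_computable.comp
      (Computable.fst.comp Computable.fst) Computable.snd))
      (Computable.const 1) (Computable.const 2)).to₂
  let Φ : Baire → Baire := fun p m => ψ (p.prefix m.unpair.1) m
  refine ⟨Φ, TotalComputable.of_modulus hψ (Computable.unpair_fst Computable.id)
    fun p m => rfl, fun p q => ?_⟩
  refine ⟨fun j => bif V ((p.pair fun _ => q 0).prefix (2 * j)) then 0 else 1, ?_, ?_⟩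
  · rw [Baire.mem_apply_iff]
    intro j
    refine ⟨1, ?_, fun m' hm' => ?_⟩
    · have : q.prefix 1 = [q 0] := rfl
      simp only [Φ, ψ, Nat.unpair_pair, this, Encodable.encodek, Option.bind_some,
        List.head?_cons, Option.map_some, Option.getD_some, constWord_prefix]
      cases V ((p.pair fun _ => q 0).prefix (2 * j)) <;> rfl
    · obtain rfl : m' = 0 := by omega
      have : q.prefix 0 = [] := rfl
      simp [Φ, ψ, this]
  · refine exists_congr fun j => ?_
    cases h : V ((p.pair fun _ => q 0).prefix (2 * j)) <;> simp [h]

/-- Single-valued functions into computable metric spaces that are reducible to choice on the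
real line are reducible to choice on the natural numbers. -/
theorem weihrauchLE_nat_of_le_real {X : Type*} [RepresentedSpace X] {Y : Type*} [MetricSpace Y]
    [ComputableMetricSpace Y] (f : X →. Y) (h : f.toMultiMap ≤W closedChoice ℝ) :
    f.toMultiMap ≤W closedChoice ℕ := by
  obtain ⟨K, H, hK, hH, hKH⟩ := h
  have hff := TotalComputable.fst.comp TotalComputable.fst
  have hreal := realName_totalComputable.comp
    ((TotalComputable.snd.comp TotalComputable.fst).pair TotalComputable.snd)
  obtain ⟨E, hE, hEs⟩ := hH.exists_apply hff TotalComputable.id hreal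
  obtain ⟨K', hK', hKs⟩ := hK.comp_total (hff.pair hreal)
  obtain ⟨F, hF, hFs⟩ := exists_typeTwoComputable_of_compact Y hE hK'
  obtain ⟨V, hV, hVs⟩ := exists_computable_isEmpty hE
  obtain ⟨Φ, hΦ, hΦs⟩ := exists_totalComputable_rejecting hV
  refine ⟨F, fun p => Part.some (Φ p), hF, hΦ, fun G hG p x hp hx => ?_⟩
  obtain ⟨a, ha, A, haA, ⟨z₀, hz₀⟩, hq⟩ := exists_instance_of_realizes hKH hp hx
  obtain ⟨y, hy⟩ := hx
  -- The preimage of `A` under binary expansion with offset coded by `r 0`.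
  let S : Baire → Set Cantor := fun r =>
    {c | ∃ z ∈ A.1, RepresentedSpace.IsName (realName (r.pair c.toBaire)) z}
  have hS : ∀ r r' : Baire, r 0 = r' 0 → S r = S r' := by
    intro r r' hr
    ext c
    simp only [S, realName_congr hr]
  have hES : ∀ (r : Baire) (c : Cantor), ∃ e ∈ E ((p.pair r).pair c.toBaire),
      ((∃ n, e n = 0) ↔ c ∉ S r) := by
    intro r c
    obtain ⟨z, hz⟩ := exists_isName_realName r c
    obtain ⟨e, he, hez⟩ := exists_mem_apply_of_isName haA hz
    refine ⟨e, hEs _ a e ?_ ?_, hez.trans (not_congr ⟨fun h => ⟨z, h, hz⟩, ?_⟩)⟩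
    · simpa only [Baire.fst_pair] using ha
    · simpa only [Baire.fst_pair, Baire.snd_pair] using he
    · rintro ⟨z', hz', hz'n⟩
      exact RepresentedSpace.unique hz'n hz ▸ hz'
  let B : Set ℕ := {n | (S fun _ => n).Nonempty}
  have hname : Realizes (Φ p).apply (charCompl B) := by
    intro q n hqn _
    obtain ⟨e, he, hej⟩ := hΦs p q
    refine ⟨e, he, _, rfl, ?_⟩
    have hqn : q 0 = n := hqn
    subst hqn
    obtain ⟨h1, h2⟩ := hVs (p.pair fun _ => q 0) (S fun _ => q 0) (hES _)
    have : (q 0 ∉ B) ↔ ∃ j, e j = 0 := by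
      rw [hej, show (q 0 ∉ B) ↔ (S fun _ => q 0) = ∅ from Set.not_nonempty_iff_eq_empty]
      constructor
      · intro hempty
        obtain ⟨k, hk⟩ := h1 hempty
        -- Only even stages are inspected; this loses nothing because acceptance of an empty set
        -- persists from stage `k` on.
        exact ⟨k, hk _ (by omega)⟩
      · rintro ⟨j, hj⟩
        exact h2 _ hj
    exact propext this
  obtain ⟨n₀, c₀, hnc⟩ := exists_realName_isName z₀
  obtain ⟨r, hr, n, hn, hrn⟩ := hG (Φ p) (⟨B, Φ p, hname⟩ : ClosedSet ℕ) hname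
    ⟨n₀, c₀, z₀, hz₀, hnc⟩
  have hrn : r 0 = n := hrn
  -- `B` was defined with constant names, whereas the oracle returns an arbitrary name `r` of `n`.
  have hne : (S r).Nonempty := by
    rw [hS r (fun _ => n) hrn]
    exact hn
  obtain ⟨q, hq, hqy⟩ := hFs (p.pair r) (S r) y hne (hES r) fun c ⟨z, hz, hzn⟩ => by
    obtain ⟨q, hq, y', hy', hqy⟩ := hq z hz _ hzn
    refine ⟨q, hKs _ q ?_, Part.mem_unique hy' hy ▸ hqy⟩
    simpa only [Baire.fst_pair, Baire.snd_pair] using hq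
  refine ⟨q, ?_, y, hy, hqy⟩
  simp only [Part.mem_bind_iff]
  exact ⟨Φ p, Part.mem_some _, r, hr, hq⟩

theorem mainTheorem6 {X : Type*} [RepresentedSpace X]
    {Y : Type*} [MetricSpace Y] [ComputableMetricSpace Y] (f : X →. Y) :
    (∀ {U V : Type*} [RepresentedSpace U] [RepresentedSpace V] (g : MultiMap U V),
      f.toMultiMap ≤W (closedChoice Cantor).prod g → f.toMultiMap ≤W g) ∧
    (f.toMultiMap ≤W closedChoice Cantor → f.toMultiMap.IsComputable) ∧
    (f.toMultiMap ≤W closedChoice ℝ → f.toMultiMap ≤W closedChoice ℕ) :=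
  ⟨fun g => weihrauchLE_of_le_cantor_prod f g, isComputable_of_le_cantor f,
    weihrauchLE_nat_of_le_real f⟩
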